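/- Let $\mathbb K$ be a field of characteristic zero and let $\mathfrak h$ be the 3-dimensional Heisenberg Lie algebra over $\mathbb K$, with basis $x_1,x_{-1},h_0$ whose only non-zero bracket (up to skew-symmetry) is $[x_1,x_{-1}]=h_0$. Let $C^{p,q}=\bigwedge^p\mathfrak h^*\otimes\bigwedge^q\mathfrak h$. The space $C^{\bullet,\bullet}=\bigoplus_{p,q}C^{p,q}$ is a super-commutative algebra with product $$(\phi\otimes v)\vee(\psi\otimes w)=(-1)^{p_2q_1}(\phi\wedge\psi)\otimes(v\wedge w),\qquad \phi\otimes v\in C^{p_1,q_1},\ \psi\otimes w\in C^{p_2,q_2},$$ and a Poisson super-algebra under the unique super-bracket $\{-,-\}$ which is super-skew-symmetric, satisfies the super-Leibniz rule with respect to $\vee$ (for the total degree $p+q$), vanishes on $\mathfrak h\times\mathfrak h$ and $\mathfrak h^*\times\mathfrak h^*$, and satisfies $\{\phi,v\}=\{v,\phi\}=\phi(v)$ for $\phi\in\mathfrak h^*$, $v\in\mathfrak h$. If $\mu\in C^{2,1}$ is the Lie bracket of $\mathfrak h$, then $d=\{\mu,-\}$ is the Chevalley--Eilenberg differential, whose cohomology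 in bidegree $(p,q)$ is $H^p(\mathfrak h,\bigwedge^q\mathfrak h)$; the bracket descends to cohomology and makes $$H_E^{\bullet,\bullet}(\mathfrak h)=\bigoplus_{p+q\ \mathrm{even}}H^p(\mathfrak h,\textstyle\bigwedge^q\mathfrak h)$$ a Lie algebra. Then: 1. $H_E^{\bullet,\bullet}(\mathfrak h)$ has dimension 18, and as a Lie algebra it is isomorphic to the semidirect product $\mathfrak{gl}(3,\mathbb K)\ltimes\mathfrak{gl}(3,\mathbb K)_{ab}$, where $\mathfrak{gl}(3,\mathbb K)_{ab}$ is the vector space $\mathfrak{gl}(3,\mathbb K)$ viewed as an abelian Lie algebra on which $\mathfrak{gl}(3,\mathbb K)$ acts by the adjoint representation. 2. A Levi factor of a finite dimensional Lie algebra is a semisimple subalgebra complementary to the radical. The Lie algebra $\operatorname{Der}(\mathfrak h)$ of derivations of $\mathfrak h$ has a Levi factor, every Levi factor of $\operatorname{Der}(\mathfrak h)$ is isomorphic to $\mathfrak{sl}(2,\mathbb K)$, and every Levi factor of $H_E^{\bullet,\bullet}(\mathfrak h)$ is isomorphic to $\mathfrak{sl}(3,\mathbb K)$. The map $D\mapsto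 -[D]$, which sends a derivation $D$, regarded as a cocycle in $C^{1,1}=\mathfrak h^*\otimes\mathfrak h$, to minus its class in $H^1(\mathfrak h,\mathfrak h)\subset H_E^{\bullet,\bullet}(\mathfrak h)$, is a homomorphism of Lie algebras; it is injective on every Levi factor of $\operatorname{Der}(\mathfrak h)$ and maps it onto a proper subalgebra of some Levi factor of $H_E^{\bullet,\bullet}(\mathfrak h)$. -/

import Mathlib

open Module

/-! ## The Poisson superalgebra `C^{•,•} = ⋀ g* ⊗ ⋀ g` of a finite dimensional Lie algebra `g` -/

namespace BigBracket

section Algebra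

variable (K : Type*) [Field K] (g : Type*) [AddCommGroup g] [Module K g]

/-- The total space `C^{•,•} = ⊕_{p,q} ⋀^p g* ⊗ ⋀^q g`. It is realised as the exterior algebra of
`g* ⊕ g`: the tensor `φ ⊗ v` is the product `φ ∧ v`, so that the product of the algebra satisfies
`(φ ⊗ v) ∨ (ψ ⊗ w) = (-1)^{p₂ q₁} (φ ∧ ψ) ⊗ (v ∧ w)` for `ψ` of degree `p₂` and `v` of
degree `q₁`. -/
abbrev Cochain : Type _ := ExteriorAlgebra K (Dual K g × g)

variable {K g}

/-- The inclusion `g* = C^{1,0} → C^{•,•}`. -/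
noncomputable def inDual : Dual K g →ₗ[K] Cochain K g :=
  ExteriorAlgebra.ι K ∘ₗ LinearMap.inl K (Dual K g) g

/-- The inclusion `g = C^{0,1} → C^{•,•}`. -/
noncomputable def inVec : g →ₗ[K] Cochain K g :=
  ExteriorAlgebra.ι K ∘ₗ LinearMap.inr K (Dual K g) g

variable (K g) in
/-- The bihomogeneous component `C^{p,q} = ⋀^p g* ⊗ ⋀^q g`. -/
noncomputable def bidegree (p q : ℕ) : Submodule K (Cochain K g) :=
  LinearMap.range (inDual (K := K) (g := g)) ^ p * LinearMap.range (inVec (K := K) (g := g)) ^ q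

/-- The grade involution, equal to `(-1)^{p+q}` on `C^{p,q}`. -/
noncomputable def parity : Cochain K g →ₐ[K] Cochain K g := CliffordAlgebra.involute

/-- The left contraction (super-derivation of degree `-1`) by a linear form on `g* ⊕ g`. -/
noncomputable def contr (f : Dual K (Dual K g × g)) : Cochain K g →ₗ[K] Cochain K g :=
  CliffordAlgebra.contractLeft f

/-- The linear form `(φ, v) ↦ φ x` on `g* ⊕ g`. -/
noncomputable def formVec (x : g) : Dual K (Dual K g × g) :=
  Dual.eval K g x ∘ₗ LinearMap.fst K (Dual K g) g

/-- The linear form `(φ, v) ↦ ψ v` on `g* ⊕ g`. -/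
noncomputable def formDual (ψ : Dual K g) : Dual K (Dual K g × g) :=
  ψ ∘ₗ LinearMap.snd K (Dual K g) g

/-- The bilinear map `(a, c) ↦ (a ⌊ f) ∨ (f' ⌋ c)`, where the right contraction `a ⌊ f` is
`parity (f ⌋ a)`. -/
noncomputable def contrPair (f f' : Dual K (Dual K g × g)) :
    Cochain K g →ₗ[K] Cochain K g →ₗ[K] Cochain K g :=
  (LinearMap.mul K (Cochain K g)).compl₁₂ (parity.toLinearMap ∘ₗ contr f) (contr f')

/-- The Poisson super-bracket, computed in a basis `b` of `g` with dual basis `b*`: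
`{a, c} = ∑ᵢ (a ⌊ bᵢ) ∨ (b*ᵢ ⌋ c) + (a ⌊ b*ᵢ) ∨ (bᵢ ⌋ c)`. -/
noncomputable def bracketOf {n : Type*} [Fintype n] (b : Basis n K g) :
    Cochain K g →ₗ[K] Cochain K g →ₗ[K] Cochain K g :=
  ∑ i, (contrPair (formVec (b i)) (formDual (b.coord i)) +
    contrPair (formDual (b.coord i)) (formVec (b i)))

/-- The Poisson super-bracket `{-,-} : C^{p₁,q₁} × C^{p₂,q₂} → C^{p₁+p₂-1,q₁+q₂-1}`, the unique
biderivation (in the super sense) with `{g, g} = {g*, g*} = 0` and `{φ, v} = {v, φ} = φ v`. The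
choice of basis is immaterial, see `pbracket_eq`. -/
noncomputable def pbracket [Module.Finite K g] :
    Cochain K g →ₗ[K] Cochain K g →ₗ[K] Cochain K g :=
  bracketOf (finBasis K g)

/-! ### The defining properties of the bracket -/

theorem contrPair_apply (f f' : Dual K (Dual K g × g)) (a c : Cochain K g) :
    contrPair f f' a c = parity (contr f a) * contr f' c := rfl

theorem sum_coord_basis_indep {M : Type*} [AddCommGroup M] [Module K M]
    {n m : Type*} [Fintype n] [Fintype m] (b : Basis n K g) (b' : Basis m K g)
    (F : g →ₗ[K] Dual K g →ₗ[K] M) :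
    ∑ i, F (b i) (b.coord i) = ∑ j, F (b' j) (b'.coord j) := by
  classical
  have h1 : ∀ i, F (b i) (b.coord i) = ∑ j, b'.coord j (b i) • F (b' j) (b.coord i) := by
    intro i
    have h : F (b i) = ∑ j, b'.coord j (b i) • F (b' j) := by
      simp_rw [← map_smul, ← map_sum]
      exact congrArg F (b'.sum_repr (b i)).symm
    rw [h]
    simp
  have h2 : ∀ j, F (b' j) (b'.coord j) = ∑ i, b'.coord j (b i) • F (b' j) (b.coord i) := by
    intro j
    have : b'.coord j = ∑ i, b'.coord j (b i) • b.coord i := by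
      refine b.ext fun k => ?_
      simp [Finsupp.single_apply]
    conv_lhs => rw [this]
    simp
  simp_rw [h1, h2]
  exact Finset.sum_comm

theorem bracketOf_apply {n : Type*} [Fintype n] (b : Basis n K g) (a c : Cochain K g) :
    bracketOf b a c = ∑ i,
      (parity (contr (formVec (b i)) a) * contr (formDual (b.coord i)) c +
        parity (contr (formDual (b.coord i)) a) * contr (formVec (b i)) c) := by
  simp [bracketOf, contrPair_apply]

theorem pbracket_eq [Module.Finite K g] {n : Type*} [Fintype n] (b : Basis n K g) :
    (pbracket : Cochain K g →ₗ[K] Cochain K g →ₗ[K] Cochain K g) = bracketOf b := by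
  refine LinearMap.ext fun a => LinearMap.ext fun c => ?_
  let u : g →ₗ[K] Cochain K g →ₗ[K] Cochain K g :=
    { toFun := fun x => contr (formVec x)
      map_add' := fun x y => by
        have : (formVec (x + y) : Dual K (Dual K g × g)) = formVec x + formVec y := by
          ext <;> simp [formVec]
        rw [this]
        exact map_add CliffordAlgebra.contractLeft _ _
      map_smul' := fun r x => by
        have : (formVec (r • x) : Dual K (Dual K g × g)) = r • formVec x := by
          ext <;> simp [formVec]
        rw [this]
        exact map_smul CliffordAlgebra.contractLeft _ _ }
  let w : Dual K g →ₗ[K] Cochain K g →ₗ[K] Cochain K g :=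
    { toFun := fun x => contr (formDual x)
      map_add' := fun x y => map_add CliffordAlgebra.contractLeft (formDual x) (formDual y)
      map_smul' := fun r x => map_smul CliffordAlgebra.contractLeft r (formDual x) }
  let F : g →ₗ[K] Dual K g →ₗ[K] Cochain K g :=
    (LinearMap.mul K (Cochain K g)).compl₁₂ (parity.toLinearMap ∘ₗ u.flip a) (w.flip c) +
    (LinearMap.mul K (Cochain K g)).flip.compl₁₂ (u.flip c) (parity.toLinearMap ∘ₗ w.flip a)
  have := sum_coord_basis_indep (finBasis K g) b F
  rw [pbracket, bracketOf_apply, bracketOf_apply]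
  exact this

theorem contr_ι (f : Dual K (Dual K g × g)) (v : Dual K g × g) :
    contr f (ExteriorAlgebra.ι K v) = algebraMap K _ (f v) :=
  CliffordAlgebra.contractLeft_ι _ f v

theorem contr_ι_mul (f : Dual K (Dual K g × g)) (v : Dual K g × g) (c : Cochain K g) :
    contr f (ExteriorAlgebra.ι K v * c) = f v • c - ExteriorAlgebra.ι K v * contr f c :=
  CliffordAlgebra.contractLeft_ι_mul f v c

theorem contr_algebraMap (f : Dual K (Dual K g × g)) (r : K) :
    contr f (algebraMap K (Cochain K g) r) = 0 :=
  CliffordAlgebra.contractLeft_algebraMap _ f r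

theorem contr_comm (f f' : Dual K (Dual K g × g)) (c : Cochain K g) :
    contr f (contr f' c) = - contr f' (contr f c) :=
  CliffordAlgebra.contractLeft_comm f f' c

theorem parity_ι (v : Dual K g × g) :
    parity (ExteriorAlgebra.ι K v) = - ExteriorAlgebra.ι K v :=
  CliffordAlgebra.involute_ι v

theorem parity_parity (c : Cochain K g) : parity (parity c) = c :=
  CliffordAlgebra.involute_involute c

theorem ext_induction {P : Cochain K g → Prop} (c : Cochain K g)
    (halg : ∀ r : K, P (algebraMap K _ r)) (hadd : ∀ x y, P x → P y → P (x + y))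
    (hmul : ∀ v x, P x → P (ExteriorAlgebra.ι K v * x)) : P c :=
  CliffordAlgebra.left_induction (0 : QuadraticForm K (Dual K g × g)) (P := P) halg hadd
    (fun x v hx => hmul v x hx) c

theorem contr_parity (f : Dual K (Dual K g × g)) (c : Cochain K g) :
    contr f (parity c) = - parity (contr f c) := by
  induction c using ext_induction with
  | halg r => simp [contr_algebraMap]
  | hadd x y hx hy => simp [hx, hy]; abel
  | hmul v x hx =>
    simp only [map_mul, parity_ι, contr_ι_mul, neg_mul, map_neg, map_sub, map_smul, hx]
    simp

theorem contr_mul (f : Dual K (Dual K g × g)) (x y : Cochain K g) :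
    contr f (x * y) = contr f x * y + parity x * contr f y := by
  induction x using ext_induction with
  | halg r => simp [contr_algebraMap, ← Algebra.smul_def]
  | hadd x z hx hz => simp only [add_mul, map_add, hx, hz]; abel
  | hmul v x hx =>
    simp only [mul_assoc, map_mul, parity_ι, contr_ι_mul, hx]
    simp only [sub_mul, mul_add, smul_mul_assoc, neg_mul, mul_assoc]
    abel

/-- Super-commutativity, when one factor has degree one. -/
theorem ι_mul_comm (v : Dual K g × g) (c : Cochain K g) :
    ExteriorAlgebra.ι K v * c = parity c * ExteriorAlgebra.ι K v := by
  induction c using ext_induction with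
  | halg r => simp [Algebra.commutes]
  | hadd x y hx hy => simp [mul_add, add_mul, hx, hy]
  | hmul w x hx =>
    have h : ExteriorAlgebra.ι K v * ExteriorAlgebra.ι K w =
        - (ExteriorAlgebra.ι K w * ExteriorAlgebra.ι K v) :=
      eq_neg_of_add_eq_zero_left (ExteriorAlgebra.ι_add_mul_swap v w)
    rw [← mul_assoc, h, map_mul, parity_ι, neg_mul, mul_assoc, hx, neg_mul, neg_mul, mul_assoc]

variable (K g) in
/-- The even part `⊕_{p+q even} C^{p,q}`: the span of the products of an even number of elements
of `g* ⊕ g`. -/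
noncomputable def evenPart : Submodule K (Cochain K g) :=
  CliffordAlgebra.evenOdd (0 : QuadraticForm K (Dual K g × g)) 0

theorem parity_of_even {c : Cochain K g} (hc : c ∈ evenPart K g) : parity c = c :=
  CliffordAlgebra.involute_eq_of_mem_even hc

theorem mem_even_iff [CharZero K] {c : Cochain K g} : c ∈ evenPart K g ↔ parity c = c := by
  refine ⟨parity_of_even, fun h => ?_⟩
  have hcompl := CliffordAlgebra.evenOdd_isCompl (0 : QuadraticForm K (Dual K g × g))
  have hc : c ∈ CliffordAlgebra.evenOdd (0 : QuadraticForm K (Dual K g × g)) 0 ⊔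
      CliffordAlgebra.evenOdd (0 : QuadraticForm K (Dual K g × g)) 1 := by
    rw [hcompl.sup_eq_top]; trivial
  obtain ⟨x, hx, y, hy, rfl⟩ := Submodule.mem_sup.1 hc
  have hx' : parity x = x := CliffordAlgebra.involute_eq_of_mem_even hx
  have hy' : parity y = -y := CliffordAlgebra.involute_eq_of_mem_odd hy
  have h2 : (2 : K) • y = 0 := by
    rw [map_add, hx', hy'] at h
    have := add_left_cancel h
    rw [two_smul]
    nth_rewrite 1 [← this]
    simp
  have : y = 0 := (smul_eq_zero.1 h2).resolve_left two_ne_zero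
  rw [this, add_zero]
  exact hx

theorem even_mul_comm {x : Cochain K g} (hx : x ∈ evenPart K g) (y : Cochain K g) :
    x * y = y * x := by
  induction y using ext_induction with
  | halg r => exact (Algebra.commutes r x).symm
  | hadd y z hy hz => simp [mul_add, add_mul, hy, hz]
  | hmul v y hy =>
    have := ι_mul_comm v x
    rw [parity_of_even hx] at this
    rw [← mul_assoc, ← this, mul_assoc, hy, mul_assoc]

theorem odd_mul_comm {x : Cochain K g} (hx : parity x = -x) (y : Cochain K g) :
    x * y = parity y * x := by
  induction y using ext_induction with
  | halg r => simp [Algebra.commutes]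
  | hadd y z hy hz => simp [mul_add, add_mul, hy, hz]
  | hmul v y hy =>
    have := ι_mul_comm v x
    rw [hx] at this
    rw [map_mul, parity_ι, mul_assoc, ← hy, ← mul_assoc, ← mul_assoc, neg_mul, this]
    simp

variable [Module.Finite K g]

theorem pbracket_apply (a c : Cochain K g) :
    pbracket a c = ∑ i,
      (parity (contr (formVec (finBasis K g i)) a) * contr (formDual ((finBasis K g).coord i)) c +
        parity (contr (formDual ((finBasis K g).coord i)) a) *
          contr (formVec (finBasis K g i)) c) :=
  bracketOf_apply _ a c

/-- The bracket with an element of degree one is a contraction. -/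
theorem pbracket_ι (a : Cochain K g) (v : Dual K g × g) :
    pbracket a (ExteriorAlgebra.ι K v) = parity (contr (formVec v.2 + formDual v.1) a) := by
  have h : formVec v.2 + formDual v.1 = ∑ i,
      ((finBasis K g).coord i v.2 • formVec (finBasis K g i) +
        v.1 (finBasis K g i) • formDual (K := K) ((finBasis K g).coord i)) := by
    ext x
    · simp only [formVec, formDual, LinearMap.comp_apply, LinearMap.add_apply,
        LinearMap.inl_apply, LinearMap.fst_apply, LinearMap.snd_apply, LinearMap.sum_apply,
        LinearMap.smul_apply, Dual.eval_apply, map_zero, add_zero, smul_zero]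
      refine (congrArg x ((finBasis K g).sum_repr v.2)).symm.trans ?_
      rw [map_sum]
      simp
    · simp only [formVec, formDual, LinearMap.comp_apply, LinearMap.add_apply,
        LinearMap.inr_apply, LinearMap.fst_apply, LinearMap.snd_apply, LinearMap.sum_apply,
        LinearMap.smul_apply, Dual.eval_apply, LinearMap.zero_apply, zero_add, smul_zero]
      refine (congrArg v.1 ((finBasis K g).sum_repr x)).symm.trans ?_
      rw [map_sum]
      simp [mul_comm]
  have hc : ∀ f : Dual K (Dual K g × g), contr f a = CliffordAlgebra.contractLeft f a :=
    fun _ => rfl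
  rw [h, pbracket_apply, hc, map_sum, LinearMap.sum_apply, map_sum]
  refine Finset.sum_congr rfl fun i _ => ?_
  simp only [map_add, map_smul, LinearMap.add_apply, LinearMap.smul_apply, contr_ι, ← hc,
    ← Algebra.commutes, ← Algebra.smul_def]
  rfl

theorem pbracket_dual_vec (φ : Dual K g) (v : g) :
    pbracket (inDual φ) (inVec v) = algebraMap K _ (φ v) := by
  simp only [inDual, inVec, LinearMap.comp_apply, pbracket_ι, contr_ι]
  simp [formVec, formDual]

theorem pbracket_vec_dual (φ : Dual K g) (v : g) :
    pbracket (inVec v) (inDual φ) = algebraMap K _ (φ v) := by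
  simp only [inDual, inVec, LinearMap.comp_apply, pbracket_ι, contr_ι]
  simp [formVec, formDual]

theorem pbracket_vec_vec (v w : g) : pbracket (K := K) (inVec v) (inVec w) = 0 := by
  simp only [inVec, LinearMap.comp_apply, pbracket_ι, contr_ι]
  simp [formVec, formDual]

theorem pbracket_dual_dual (φ ψ : Dual K g) : pbracket (inDual φ) (inDual ψ) = 0 := by
  simp only [inDual, LinearMap.comp_apply, pbracket_ι, contr_ι]
  simp [formVec, formDual]

theorem parity_pbracket (a c : Cochain K g) :
    parity (pbracket a c) = pbracket (parity a) (parity c) := by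
  simp only [pbracket_apply, map_sum, map_add, map_mul, contr_parity, map_neg, neg_mul_neg]

/-- The Leibniz rule with an even first factor. -/
theorem pbracket_even_mul (a : Cochain K g) {x : Cochain K g} (hx : x ∈ evenPart K g)
    (c : Cochain K g) : pbracket a (x * c) = pbracket a x * c + x * pbracket a c := by
  simp only [pbracket_apply, contr_mul, parity_of_even hx, Finset.sum_mul, Finset.mul_sum,
    ← Finset.sum_add_distrib]
  refine Finset.sum_congr rfl fun i _ => ?_
  simp only [mul_add, add_mul, ← mul_assoc, even_mul_comm hx]
  abel

/-- The Leibniz rule with an odd first factor. -/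
theorem pbracket_odd_mul (a : Cochain K g) {x : Cochain K g} (hx : parity x = -x)
    (c : Cochain K g) :
    pbracket a (x * c) = pbracket a x * c + x * pbracket (parity a) c := by
  simp only [pbracket_apply, contr_mul, hx, Finset.sum_mul, Finset.mul_sum,
    ← Finset.sum_add_distrib]
  refine Finset.sum_congr rfl fun i _ => ?_
  have h : ∀ y z, x * (y * z) = parity y * x * z := fun y z => by
    rw [← mul_assoc, odd_mul_comm hx]
  simp only [mul_add, add_mul, h, ← mul_assoc, contr_parity, map_neg, mul_neg, neg_mul,
    parity_parity]
  abel

/-- Skew-symmetry when one argument is even. -/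
theorem pbracket_skew_even {b : Cochain K g} (hb : b ∈ evenPart K g) (a : Cochain K g) :
    pbracket b a = - pbracket a b := by
  have hodd : ∀ f, parity (contr f b) = - contr f b := fun f => by
    have := contr_parity f b
    rw [parity_of_even hb] at this
    rw [eq_neg_iff_add_eq_zero, ← eq_neg_iff_add_eq_zero, ← neg_eq_iff_eq_neg]
    exact this.symm
  simp only [pbracket_apply, ← Finset.sum_neg_distrib]
  refine Finset.sum_congr rfl fun i _ => ?_
  rw [hodd, hodd, ← odd_mul_comm (hodd _), ← odd_mul_comm (hodd _)]
  simp only [neg_mul]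
  abel

/-- Skew-symmetry when one argument is odd. -/
theorem pbracket_skew_odd [CharZero K] {x : Cochain K g} (hx : parity x = -x) (a : Cochain K g) :
    pbracket a x = - pbracket x (parity a) := by
  have hev : ∀ f, parity (contr f x) = contr f x := fun f => by
    have := contr_parity f x
    rw [hx, map_neg] at this
    exact (neg_injective this).symm
  simp only [pbracket_apply, ← Finset.sum_neg_distrib]
  refine Finset.sum_congr rfl fun i _ => ?_
  rw [hev, hev, even_mul_comm (mem_even_iff.2 (hev _)), even_mul_comm (mem_even_iff.2 (hev _)),
    contr_parity, contr_parity]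
  simp only [neg_mul]
  abel

theorem contr_pbracket (f : Dual K (Dual K g × g)) (b a : Cochain K g) :
    parity (contr f (pbracket b a)) =
      pbracket b (parity (contr f a)) + pbracket (parity (contr f b)) (parity a) := by
  simp only [pbracket_apply, map_sum, ← Finset.sum_add_distrib]
  refine Finset.sum_congr rfl fun i _ => ?_
  simp only [map_add, contr_mul, contr_parity, map_mul, map_neg, parity_parity,
    contr_comm f, mul_neg, neg_mul, neg_neg]
  abel

/-- The super-Jacobi identity, when one argument is even. -/
theorem pbracket_jacobi [CharZero K] {b : Cochain K g} (hb : b ∈ evenPart K g)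
    (a c : Cochain K g) :
    pbracket b (pbracket a c) = pbracket (pbracket b a) c + pbracket a (pbracket b c) := by
  have hbp := parity_of_even hb
  induction c using ext_induction generalizing a with
  | halg r =>
    have h0 : ∀ x : Cochain K g, pbracket x (algebraMap K _ r) = 0 := fun x => by
      simp [pbracket_apply, contr_algebraMap]
    simp [h0]
  | hadd x y hx hy => simp only [map_add, hx, hy]; abel
  | hmul v c ih =>
    have hv : parity (ExteriorAlgebra.ι K v : Cochain K g) = - ExteriorAlgebra.ι K v := parity_ι v
    have hbv : parity (pbracket b (ExteriorAlgebra.ι K v)) =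
        - pbracket b (ExteriorAlgebra.ι K v) := by
      rw [parity_pbracket, hbp, hv, map_neg]
    have hD : ∀ x y : Cochain K g, pbracket b (x * y) = pbracket b x * y + x * pbracket b y := by
      intro x y
      induction x using ext_induction with
      | halg r => 
        have h0 : pbracket b (algebraMap K (Cochain K g) r) = 0 := by
          simp [pbracket_apply, contr_algebraMap]
        rw [h0]
        simp [← Algebra.smul_def]
      | hadd x z hx hz => simp only [add_mul, map_add, hx, hz]; abel
      | hmul w x hx =>
        rw [mul_assoc, pbracket_odd_mul b (parity_ι w), pbracket_odd_mul b (parity_ι w), hbp, hx]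
        simp only [mul_add, add_mul, mul_assoc]
        abel
    have hbase : pbracket b (pbracket a (ExteriorAlgebra.ι K v)) =
        pbracket (pbracket b a) (ExteriorAlgebra.ι K v) +
          pbracket a (pbracket b (ExteriorAlgebra.ι K v)) := by
      rw [pbracket_skew_odd hbv a]
      simp only [pbracket_ι]
      rw [contr_pbracket]
      abel
    rw [pbracket_odd_mul a hv, pbracket_odd_mul (pbracket b a) hv, map_add, hD, hD, hD, map_add,
      pbracket_odd_mul a hv, pbracket_odd_mul a hbv, hbase, ih, parity_pbracket, hbp]
    simp only [mul_add, add_mul]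
    abel

theorem pbracket_mem_even [CharZero K] {a b : Cochain K g} (ha : a ∈ evenPart K g)
    (hb : b ∈ evenPart K g) : pbracket a b ∈ evenPart K g := by
  rw [mem_even_iff, parity_pbracket, parity_of_even ha, parity_of_even hb]

variable (K g) in
/-- The even cochains `C_E = ⊕_{p+q even} C^{p,q}`, a Lie algebra under the Poisson bracket. -/
def EvenCochain : Type _ := ↥(evenPart K g)

noncomputable instance : AddCommGroup (EvenCochain K g) :=
  inferInstanceAs (AddCommGroup ↥(evenPart K g))

noncomputable instance : Module K (EvenCochain K g) :=
  inferInstanceAs (Module K ↥(evenPart K g))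

/-- The inclusion of the even cochains in all cochains. -/
noncomputable def EvenCochain.val : EvenCochain K g →ₗ[K] Cochain K g := (evenPart K g).subtype

theorem EvenCochain.val_mem (a : EvenCochain K g) : a.val ∈ evenPart K g := Subtype.property a

theorem EvenCochain.val_injective :
    Function.Injective (EvenCochain.val : EvenCochain K g → Cochain K g) :=
  Subtype.val_injective

variable [CharZero K]

noncomputable instance : Bracket (EvenCochain K g) (EvenCochain K g) where
  bracket a b := ⟨pbracket a.val b.val, pbracket_mem_even a.val_mem b.val_mem⟩

theorem EvenCochain.val_lie (a b : EvenCochain K g) : ⁅a, b⁆.val = pbracket a.val b.val := rfl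

noncomputable instance : LieRing (EvenCochain K g) where
  add_lie a b c := EvenCochain.val_injective (by simp [EvenCochain.val_lie])
  lie_add a b c := EvenCochain.val_injective (by simp [EvenCochain.val_lie])
  lie_self a := EvenCochain.val_injective (by
    rw [EvenCochain.val_lie, map_zero]
    have h := pbracket_skew_even a.val_mem a.val
    have h2 : (2 : K) • pbracket a.val a.val = 0 := by
      rw [two_smul]
      nth_rewrite 1 [h]
      simp
    exact (smul_eq_zero.1 h2).resolve_left two_ne_zero)
  leibniz_lie a b c := EvenCochain.val_injective (by
    simp only [EvenCochain.val_lie, map_add]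
    exact pbracket_jacobi a.val_mem b.val c.val)

noncomputable instance : LieAlgebra K (EvenCochain K g) where
  lie_smul t a b := EvenCochain.val_injective (by simp [EvenCochain.val_lie])

end Algebra

/-! ## The even cohomology of a Lie algebra with coefficients in its exterior algebra -/

section Cohomology

variable (K : Type*) [Field K] [CharZero K]
variable (g : Type*) [LieRing g] [LieAlgebra K g] [Module.Finite K g]

/-- The element `μ ∈ C^{2,1} = ⋀² g* ⊗ g` given by the Lie bracket of `g`:
`μ = ∑_{i<j} (b*ᵢ ∧ b*ⱼ) ⊗ ⁅bᵢ, bⱼ⁆` for any basis `b`. -/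
noncomputable def mu : Cochain K g :=
  (2⁻¹ : K) • ∑ i, ∑ j, inDual ((finBasis K g).coord i) * inDual ((finBasis K g).coord j) *
    inVec ⁅finBasis K g i, finBasis K g j⁆

variable {K g} in
theorem mu_eq {n : Type*} [Fintype n] (b : Basis n K g) :
    mu K g = (2⁻¹ : K) • ∑ i, ∑ j, inDual (b.coord i) * inDual (b.coord j) *
      inVec ⁅b i, b j⁆ := by
  rw [mu]
  congr 1
  let F (x : g) (φ : Dual K g) : g →ₗ[K] Dual K g →ₗ[K] Cochain K g :=
    LinearMap.mk₂ K (fun y ψ => inDual φ * inDual ψ * inVec ⁅x, y⁆)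
      (by intros; simp [mul_add]) (by intros; simp)
      (by intros; simp [mul_add, add_mul]) (by intros; simp)
  let G : g →ₗ[K] Dual K g →ₗ[K] Cochain K g :=
    LinearMap.mk₂ K (fun x φ => ∑ j, inDual φ * inDual (b.coord j) * inVec ⁅x, b j⁆)
      (by intros; simp [mul_add, Finset.sum_add_distrib]) (by intros; simp [Finset.smul_sum])
      (by intros; simp [add_mul, Finset.sum_add_distrib]) (by intros; simp [Finset.smul_sum])
  have h1 := fun i => sum_coord_basis_indep (finBasis K g) b
    (F (finBasis K g i) ((finBasis K g).coord i))
  have h2 := sum_coord_basis_indep (finBasis K g) b G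
  simp only [F, G, LinearMap.mk₂_apply] at h1 h2
  simp_rw [h1]
  exact h2

/-- The Chevalley-Eilenberg differential `d = {μ, -} : C^{p,q} → C^{p+1,q}`. -/
noncomputable def diff : Cochain K g →ₗ[K] Cochain K g := pbracket (mu K g)

/-- The even cocycles, a Lie subalgebra of the even cochains. -/
noncomputable def evenCocycles : LieSubalgebra K (EvenCochain K g) where
  carrier := {a | diff K g a.val = 0}
  add_mem' := fun {a b} ha hb => by
    simp only [Set.mem_ofPred_eq] at *
    simp [ha, hb]
  zero_mem' := by simp
  smul_mem' := fun t a ha => by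
    simp only [Set.mem_ofPred_eq] at *
    simp [ha]
  lie_mem' := fun {a b} ha hb => by
    simp only [Set.mem_ofPred_eq, diff] at *
    change diff K g a.val = 0 at ha
    change diff K g b.val = 0 at hb
    rw [diff] at ha hb
    rw [EvenCochain.val_lie]
    have h := pbracket_jacobi a.val_mem (mu K g) b.val
    rw [hb, map_zero, pbracket_skew_even a.val_mem (mu K g), ha, neg_zero, map_zero,
      LinearMap.zero_apply, zero_add] at h
    exact h.symm

/-- The even coboundaries (the even elements of the image of `d`), a Lie ideal of the even cocycles. -/
noncomputable def evenCoboundaries : LieIdeal K (evenCocycles K g) where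
  carrier := {z | ∃ c : Cochain K g, diff K g c = z.val.val}
  add_mem' := by
    rintro z w ⟨c, hc⟩ ⟨e, he⟩
    exact ⟨c + e, by simp [hc, he]⟩
  zero_mem' := ⟨0, by simp⟩
  smul_mem' := by
    rintro t z ⟨c, hc⟩
    exact ⟨t • c, by simp [hc]⟩
  lie_mem := by
    rintro a z ⟨c, hc⟩
    refine ⟨pbracket a.val.val c, ?_⟩
    have ha : pbracket (mu K g) a.val.val = 0 := a.property
    have h := pbracket_jacobi a.val.val_mem (mu K g) c
    rw [pbracket_skew_even a.val.val_mem (mu K g), ha, neg_zero, map_zero, LinearMap.zero_apply,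
      zero_add] at h
    rw [diff] at hc ⊢
    rw [← h, hc]
    rfl

/-- The even cohomology `H_E^{•,•}(g) = ⊕_{p+q even} H^p(g, ⋀^q g)`, a Lie algebra under the
bracket induced by the Poisson bracket of cochains. -/
abbrev EvenCohomology : Type _ := evenCocycles K g ⧸ evenCoboundaries K g

variable {K g} in
/-- The cohomology class of an even cocycle. -/
noncomputable def cohClass : evenCocycles K g →ₗ[K] EvenCohomology K g :=
  (evenCoboundaries K g).toSubmodule.mkQ

/-- The component `H^p(g, ⋀^q g)` of the even cohomology, for `p + q` even: the classes of the
cocycles of bidegree `(p, q)`. -/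
noncomputable def cohBidegree (p q : ℕ) : Submodule K (EvenCohomology K g) :=
  ((bidegree K g p q).comap
    (EvenCochain.val ∘ₗ (evenCocycles K g).toSubmodule.subtype)).map cohClass

variable {K g} in
/-- The cochain in `C^{1,1} = g* ⊗ g` of a linear endomorphism `D` of `g`, namely
`∑ᵢ b*ᵢ ⊗ D bᵢ` for any basis `b`. -/
noncomputable def endCochain (D : g →ₗ[K] g) : Cochain K g :=
  ∑ i, inDual ((finBasis K g).coord i) * inVec (D (finBasis K g i))

end Cohomology

end BigBracket

/-! ## Lie algebras -/

/-- `x = (x₁, x₋₁, h₀)` is a basis of a three dimensional Heisenberg Lie algebra: the only nonzero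
bracket is `⁅x₁, x₋₁⁆ = h₀`, up to skew-symmetry. -/
structure IsHeisenbergBasis {K h : Type*} [Field K] [LieRing h] [LieAlgebra K h]
    (x : Basis (Fin 3) K h) : Prop where
  lie_zero_one : ⁅x 0, x 1⁆ = x 2
  lie_zero_two : ⁅x 0, x 2⁆ = 0
  lie_one_two : ⁅x 1, x 2⁆ = 0

/-- The general linear Lie algebra `gl(n, K)`: matrices with the commutator bracket. -/
noncomputable instance instLieRingGl (n : ℕ) (K : Type*) [Field K] :
    LieRing (Matrix (Fin n) (Fin n) K) :=
  LieRing.ofAssociativeRing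

noncomputable instance instLieAlgebraGl (n : ℕ) (K : Type*) [Field K] :
    LieAlgebra K (Matrix (Fin n) (Fin n) K) :=
  LieAlgebra.ofAssociativeAlgebra

/-- `gl(n, K)_ab`: the vector space of matrices as an abelian Lie algebra. -/
def GlAb (n : ℕ) (K : Type*) : Type _ := Matrix (Fin n) (Fin n) K

noncomputable instance (n : ℕ) (K : Type*) [Field K] : AddCommGroup (GlAb n K) :=
  inferInstanceAs (AddCommGroup (Matrix (Fin n) (Fin n) K))

noncomputable instance (n : ℕ) (K : Type*) [Field K] : Module K (GlAb n K) :=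
  inferInstanceAs (Module K (Matrix (Fin n) (Fin n) K))

noncomputable instance (n : ℕ) (K : Type*) [Field K] : LieRing (GlAb n K) where
  bracket _ _ := 0
  add_lie _ _ _ := (add_zero 0).symm
  lie_add _ _ _ := (add_zero 0).symm
  lie_self _ := rfl
  leibniz_lie _ _ _ := (add_zero 0).symm

noncomputable instance (n : ℕ) (K : Type*) [Field K] : LieAlgebra K (GlAb n K) where
  lie_smul t _ _ := (smul_zero t).symm

theorem GlAb.lie_eq_zero (n : ℕ) (K : Type*) [Field K] (A B : GlAb n K) : ⁅A, B⁆ = 0 := rfl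

/-- The identity, as a linear equivalence `gl(n, K) → gl(n, K)_ab`. -/
noncomputable def GlAb.of (n : ℕ) (K : Type*) [Field K] :
    Matrix (Fin n) (Fin n) K ≃ₗ[K] GlAb n K :=
  LinearEquiv.refl K (Matrix (Fin n) (Fin n) K)

/-- The adjoint representation of `gl(n, K)` on the vector space `gl(n, K)_ab`, by derivations of
the abelian Lie algebra. -/
noncomputable def glAdjoint (n : ℕ) (K : Type*) [Field K] :
    Matrix (Fin n) (Fin n) K →ₗ⁅K⁆ LieDerivation K (GlAb n K) (GlAb n K) where
  toFun X :=
    { toLinearMap := (GlAb.of n K).conj (LieAlgebra.ad K (Matrix (Fin n) (Fin n) K) X)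
      leibniz' := fun A B => by
        rw [GlAb.lie_eq_zero, GlAb.lie_eq_zero, GlAb.lie_eq_zero, map_zero, sub_zero] }
  map_add' X Y := by
    ext A : 1
    change GlAb.of n K ⁅X + Y, (GlAb.of n K).symm A⁆ =
      GlAb.of n K ⁅X, (GlAb.of n K).symm A⁆ + GlAb.of n K ⁅Y, (GlAb.of n K).symm A⁆
    rw [add_lie, map_add]
  map_smul' t X := by
    ext A : 1
    change GlAb.of n K ⁅t • X, (GlAb.of n K).symm A⁆ = t • GlAb.of n K ⁅X, (GlAb.of n K).symm A⁆
    rw [smul_lie, map_smul]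
  map_lie' {X Y} := by
    ext A : 1
    rw [LieDerivation.commutator_apply]
    change GlAb.of n K ⁅⁅X, Y⁆, (GlAb.of n K).symm A⁆ =
      GlAb.of n K ⁅X, ⁅Y, (GlAb.of n K).symm A⁆⁆ - GlAb.of n K ⁅Y, ⁅X, (GlAb.of n K).symm A⁆⁆
    rw [lie_lie, map_sub]

/-- The semidirect product `gl(n, K) ⋉ gl(n, K)_ab`. -/
abbrev GlSemidirect (n : ℕ) (K : Type*) [Field K] : Type _ :=
  LieAlgebra.SemiDirectSum (GlAb n K) (Matrix (Fin n) (Fin n) K) (glAdjoint n K)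

/-- A Levi factor: a semisimple subalgebra that is a vector space complement of the radical. -/
structure IsLeviFactor {K L : Type*} [Field K] [LieRing L] [LieAlgebra K L]
    (S : LieSubalgebra K L) : Prop where
  semisimple : LieAlgebra.IsSemisimple K S
  isCompl : IsCompl S.toSubmodule (LieAlgebra.radical K L).toSubmodule

/-! ## Lie algebra generalities -/

namespace LieAlgebra

/-! ### Radicals and Levi factors read off from a quotient map. -/

section Radical

variable {K L Q : Type*} [Field K] [LieRing L] [LieAlgebra K L] [LieRing Q] [LieAlgebra K Q]

/-! The cochain algebra is the exterior algebra of `h* ⊕ h`, and its bracket comes from the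
canonical symmetric pairing there. Split `h* ⊕ h` into Lagrangians differently: let `W` be spanned
by the positions `x₁*, x₋₁*, h₀`, and let `W*` be spanned by the momenta `x₁, x₋₁, h₀*`. Then `μ`
becomes the volume element `pos 0 * pos 1 * pos 2` of `W` (`mu_eq_pos`). This exhibits a hidden
`sl(W) = sl(3)` symmetry, larger than the `sl(2)` visible in the original grading.

A matrix `M` gives the quadratic element `quad M` in `W ⊗ W*`; bracketing with it acts by `M` on `W`
and contragrediently on `W*`. It is closed exactly when `tr M = 0`. Put `e = quad 1`. The elements
`1`, traceless `quad M`, `e * quad N` and `e³` are closed, while `e²` is exact. Hence `repr (N, M)`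
lets `1` carry the trace of `M` and `e³` the trace of `N`. These representatives satisfy the
brackets of `gl(3) ⋉ gl(3)_ab` already as cochains (`pbracket_repr`).

That they form the whole cohomology follows from duality. The Berezin integral kills every bracket,
so it makes even cocycles orthogonal to coboundaries (`berezin_mul_diff`). Testing a cocycle against
explicit coboundaries removes all components which are neither exact nor represented
(`exists_repr_add_diff`). Testing an exact representative against the closed elements above gives
trace forms in `M` and `N`, which force both to vanish (`repr_eq_zero_of_exact`). The original
bigrading is recovered from the eigenvalues `2^p * 3^q` of a scaling automorphism.

For Levi factors, a surjection with solvable kernel onto an algebra with trivial radical has the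
radical as kernel, so Levi factors are exactly carried onto the target. The action on the
abelianization of `h` gives `Der h → sl(2)`, and the `gl(3)` component gives `H_E → sl(3)`, both
modulo scalars. Up to exact terms, `-D` is `quad` of a traceless block diagonal matrix
(`endCochain_eq_quad`). Hence `D ↦ -[D]` lands in one fixed copy of `sl(3)`, misses its off-block
entries, and has kernel inside the radical of `Der h`. -/

theorem map_derivedSeriesOfIdeal (f : L →ₗ⁅K⁆ Q) (hf : Function.Surjective f)
    (I : LieIdeal K L) (k : ℕ) :
    (derivedSeriesOfIdeal K L k I).map f = derivedSeriesOfIdeal K Q k (I.map f) := by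
  induction k with
  | zero => rfl
  | succ k ih =>
    rw [derivedSeriesOfIdeal_succ, derivedSeriesOfIdeal_succ, LieIdeal.map_bracket_eq f hf, ih]

theorem isSolvable_map (f : L →ₗ⁅K⁆ Q) (hf : Function.Surjective f) (I : LieIdeal K L)
    [hI : IsSolvable I] : IsSolvable (I.map f) := by
  obtain ⟨k, hk⟩ := (isSolvable_iff K I).1 hI
  refine (isSolvable_iff K _).2 ⟨k, ?_⟩
  rw [LieIdeal.derivedSeries_eq_bot_iff] at hk ⊢
  rw [← map_derivedSeriesOfIdeal f hf, hk, LieIdeal.map_eq_bot_iff]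
  exact bot_le

/-- If the quotient by a solvable ideal has trivial radical, that ideal is the radical. -/
theorem radical_eq_ker [Module.Finite K L] [HasTrivialRadical K Q] (f : L →ₗ⁅K⁆ Q)
    (hf : Function.Surjective f) (hker : IsSolvable f.ker) : radical K L = f.ker := by
  apply le_antisymm
  · have := isSolvable_map f hf (radical K L)
    exact LieIdeal.map_eq_bot_iff.1
      (HasTrivialRadical.eq_bot_of_isSolvable ((radical K L).map f))
  · exact (LieIdeal.solvable_iff_le_radical K L f.ker).1 hker

theorem bijective_of_isCompl_ker (f : L →ₗ⁅K⁆ Q) (hf : Function.Surjective f)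
    (S : LieSubalgebra K L) (hS : IsCompl S.toSubmodule f.ker.toSubmodule) :
    Function.Bijective (f.comp S.incl) := by
  constructor
  · rw [injective_iff_map_eq_zero]
    intro a ha
    have h := (Submodule.disjoint_def.1 hS.disjoint) a.val a.property (LieHom.mem_ker.2 ha)
    exact Subtype.ext h
  · intro q
    obtain ⟨l, rfl⟩ := hf q
    obtain ⟨s, hs, k, hk, rfl⟩ := Submodule.mem_sup.1
      (hS.sup_eq_top ▸ Submodule.mem_top : l ∈ S.toSubmodule ⊔ f.ker.toSubmodule)
    refine ⟨⟨s, hs⟩, ?_⟩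
    have hk' : f k = 0 := LieHom.mem_ker.1 hk
    change f s = f (s + k)
    rw [map_add, hk', add_zero]

theorem isCompl_ker_of_bijective (f : L →ₗ⁅K⁆ Q)
    (S : LieSubalgebra K L) (hS : Function.Bijective (f.comp S.incl)) :
    IsCompl S.toSubmodule f.ker.toSubmodule := by
  constructor
  · rw [Submodule.disjoint_def]
    intro a ha hk
    have h : (⟨a, ha⟩ : S) = 0 := hS.1 (by
      rw [map_zero]
      exact LieHom.mem_ker.1 hk)
    exact congrArg Subtype.val h
  · rw [codisjoint_iff, eq_top_iff]
    intro l _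
    obtain ⟨s, hs⟩ := hS.2 (f l)
    refine Submodule.mem_sup.2 ⟨s.val, s.property, l - s.val, ?_, by abel⟩
    refine LieHom.mem_ker.2 ?_
    have hs' : f s.val = f l := hs
    rw [map_sub, hs', sub_self]

/-- Levi factors are sections of the quotient by the radical. -/
theorem leviFactor_equiv [Module.Finite K L] [HasTrivialRadical K Q] (f : L →ₗ⁅K⁆ Q)
    (hf : Function.Surjective f) (hker : IsSolvable f.ker) (S : LieSubalgebra K L)
    (hS : IsLeviFactor S) : Nonempty (S ≃ₗ⁅K⁆ Q) :=
  ⟨LieEquiv.ofBijective (f.comp S.incl)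
    (bijective_of_isCompl_ker f hf S (radical_eq_ker f hf hker ▸ hS.isCompl))⟩

/-- The kernel is the radical, so a section of the quotient is a complement of it. Semisimplicity is
transported from `Q` through nondegeneracy of the Killing form in characteristic zero. -/
theorem isLeviFactor_of_bijective [CharZero K] [Module.Finite K L] [HasTrivialRadical K Q]
    (f : L →ₗ⁅K⁆ Q) (hker : IsSolvable f.ker) (S : LieSubalgebra K L)
    (hS : Function.Bijective (f.comp S.incl)) : IsLeviFactor S where
  semisimple := by
    let e : Q ≃ₗ⁅K⁆ S := (LieEquiv.ofBijective (f.comp S.incl) hS).symm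
    have : Module.Finite K Q := Module.Finite.equiv e.toLinearEquiv.symm
    have := isKilling_of_equiv e
    infer_instance
  isCompl := by
    have hf : Function.Surjective f := fun q => by
      obtain ⟨s, hs⟩ := hS.2 q
      exact ⟨s.val, hs⟩
    rw [radical_eq_ker f hf hker]
    exact isCompl_ker_of_bijective f S hS

end Radical

/-! ### The special linear algebra and the projection of `gl(n)` onto it. -/

namespace SpecialLinear

variable (n K : Type*) [Fintype n] [DecidableEq n] [Field K]

attribute [local instance] LieRing.ofAssociativeRing

theorem mem_sl {n K : Type*} [Fintype n] [DecidableEq n] [Field K] {A : Matrix n n K} :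
    A ∈ sl n K ↔ A.trace = 0 := Iff.rfl

/-- The special linear Lie algebra in characteristic zero has trivial radical: an element `X` of
an abelian ideal satisfies `[X, [X, Y]] = 0` for all `Y`, hence is scalar. -/
instance hasTrivialRadical [CharZero K] : HasTrivialRadical K (sl n K) := by
  rw [hasTrivialRadical_iff_no_abelian_ideals]
  intro I hI
  rw [LieSubmodule.eq_bot_iff]
  intro X hX
  have hdouble (Y : sl n K) : ⁅X, ⁅X, Y⁆⁆ = 0 := by
    have hXY : ⁅X, Y⁆ ∈ I := by
      rw [← lie_skew]
      exact I.neg_mem (I.lie_mem hX)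
    have h := hI.trivial (⟨X, hX⟩ : I) ⟨⁅X, Y⁆, hXY⟩
    exact congrArg (fun z : I => (z : sl n K)) h
  set A : Matrix n n K := X.val with hA
  have htr : A.trace = 0 := mem_sl.1 X.property
  have hsl (Y : Matrix n n K) (hY : Y.trace = 0) : A * (A * Y - Y * A) = (A * Y - Y * A) * A := by
    have h := congrArg Subtype.val (hdouble ⟨Y, mem_sl.2 hY⟩)
    exact sub_eq_zero.1 h
  have hunit (M N : Matrix n n K) (i j a b : n) :
      (M * (Matrix.single j i 1 : Matrix n n K) * N) a b = M a j * N i b := by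
    rw [Matrix.mul_apply, Finset.sum_eq_single i]
    · simp
    · intro k _ hk
      rw [Matrix.mul_single_apply_of_ne _ _ _ _ _ hk, zero_mul]
    · simp
  -- The `(a, b)` entry of `A² Y + Y A² = 2 A Y A`, which is `[A, [A, Y]] = 0`, for the elementary
  -- matrix `Y = E_{ji}`.
  have hentry (i j a b : n) (hij : i ≠ j) :
      (A * A) a j * (1 : Matrix n n K) i b + (1 : Matrix n n K) a j * (A * A) i b =
        2 * (A a j * A i b) := by
    have h := hsl (Matrix.single j i 1) (Matrix.trace_single_eq_of_ne _ _ _ hij.symm)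
    have h2 : A * A * (Matrix.single j i 1 : Matrix n n K) * 1 + 1 * Matrix.single j i 1 * (A * A) =
        (2 : K) • (A * Matrix.single j i 1 * A) := by
      rw [mul_sub, sub_mul, sub_eq_iff_eq_add] at h
      rw [mul_one, one_mul, two_smul, mul_assoc, h]
      simp only [mul_assoc]
      abel
    have h3 := congrFun (congrFun h2 a) b
    simpa only [Matrix.add_apply, Matrix.smul_apply, hunit, smul_eq_mul] using h3
  have hoff (i j : n) (hij : i ≠ j) : A i j = 0 := by
    have h := hentry i j i j hij
    rw [Matrix.one_apply_ne hij, mul_zero, zero_mul, add_zero] at h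
    simpa using h.symm
  have hsq (i : n) : (A * A) i i = A i i * A i i := by
    rw [Matrix.mul_apply, Finset.sum_eq_single i]
    · intro k _ hk
      rw [hoff k i hk, mul_zero]
    · simp
  have hdiag (i j : n) : A j j = A i i := by
    by_cases hij : i = j
    · rw [hij]
    have h := hentry i j j i hij
    rw [Matrix.one_apply_eq, Matrix.one_apply_eq, hsq, hsq] at h
    -- With off-diagonal entries gone, the entry `(j, i)` reads `A_jj² + A_ii² = 2 A_jj A_ii`.
    have h2 : (A j j - A i i) ^ 2 = 0 := by linear_combination h
    exact sub_eq_zero.1 (pow_eq_zero_iff two_ne_zero |>.1 h2)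
  refine Subtype.ext (Matrix.ext fun i j => ?_)
  change A i j = 0
  by_cases hij : i = j
  · subst hij
    have h : (Fintype.card n : K) * A i i = 0 := by
      rw [← htr, Matrix.trace]
      simp [hdiag i]
    have : Nonempty n := ⟨i⟩
    exact (mul_eq_zero.1 h).resolve_left (Nat.cast_ne_zero.2 Fintype.card_ne_zero)
  · exact hoff i j hij

/-- The projection of `gl(n)` onto `sl(n)` along the scalar matrices. -/
noncomputable def tracelessPart [CharZero K] [Nonempty n] : Matrix n n K →ₗ⁅K⁆ sl n K where
  toFun A := ⟨A - ((Fintype.card n : K)⁻¹ * A.trace) • (1 : Matrix n n K), mem_sl.2 (by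
    simp [mul_comm])⟩
  map_add' A B := Subtype.ext (by
    change _ = (A - ((Fintype.card n : K)⁻¹ * A.trace) • (1 : Matrix n n K)) +
      (B - ((Fintype.card n : K)⁻¹ * B.trace) • (1 : Matrix n n K))
    simp only [Matrix.trace_add]
    module)
  map_smul' t A := Subtype.ext (by
    change _ = t • (A - ((Fintype.card n : K)⁻¹ * A.trace) • (1 : Matrix n n K))
    simp only [Matrix.trace_smul, smul_eq_mul]
    module)
  map_lie' {A B} := Subtype.ext (by
    have htr : (A * B - B * A).trace = 0 := matrix_trace_commutator_zero n K A B
    simp only [LieSubalgebra.coe_bracket, Ring.lie_def]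
    simp only [htr, mul_zero, zero_smul, sub_zero]
    simp only [mul_sub, sub_mul, smul_mul_assoc, mul_smul_comm, one_mul, mul_one]
    module)

theorem coe_tracelessPart [CharZero K] [Nonempty n] (A : Matrix n n K) :
    (tracelessPart n K A : Matrix n n K) =
      A - ((Fintype.card n : K)⁻¹ * A.trace) • (1 : Matrix n n K) := rfl

theorem tracelessPart_coe [CharZero K] [Nonempty n] (A : sl n K) :
    tracelessPart n K A = A :=
  Subtype.ext (by rw [coe_tracelessPart, mem_sl.1 A.property, mul_zero, zero_smul, sub_zero])

end SpecialLinear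

end LieAlgebra

/-! ## Derivation properties of the super-bracket -/

namespace BigBracket

section Derivation

variable {K : Type*} [Field K] {g : Type*} [AddCommGroup g] [Module K g]

theorem ι_mul_ι_mem_even (v v' : Dual K g × g) :
    (ExteriorAlgebra.ι K v * ExteriorAlgebra.ι K v' : Cochain K g) ∈ evenPart K g :=
  CliffordAlgebra.ι_mul_ι_mem_evenOdd_zero _ v v'

theorem one_mem_even : (1 : Cochain K g) ∈ evenPart K g :=
  CliffordAlgebra.one_le_evenOdd_zero _ (Submodule.one_le.1 le_rfl)

theorem mul_mem_even {a b : Cochain K g} (ha : a ∈ evenPart K g) (hb : b ∈ evenPart K g) :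
    a * b ∈ evenPart K g :=
  CliffordAlgebra.evenOdd_mul_le (0 : QuadraticForm K (Dual K g × g)) 0 0
    (Submodule.mul_mem_mul ha hb)

/-- The linear form `⟨v, -⟩` for the canonical symmetric pairing of `g* ⊕ g`. -/
noncomputable def pairing (v : Dual K g × g) : Dual K (Dual K g × g) :=
  formVec v.2 + formDual v.1

theorem pairing_apply (v v' : Dual K g × g) : pairing v v' = v'.1 v.2 + v.1 v'.2 := rfl

@[simp]
theorem contr_one (f : Dual K (Dual K g × g)) : contr f (1 : Cochain K g) = 0 := by
  rw [← map_one (algebraMap K (Cochain K g)), contr_algebraMap]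

variable [Module.Finite K g]

theorem pbracket_ι_right (a : Cochain K g) (v : Dual K g × g) :
    pbracket a (ExteriorAlgebra.ι K v) = parity (contr (pairing v) a) :=
  pbracket_ι a v

theorem pbracket_one (a : Cochain K g) : pbracket a 1 = 0 := by
  simp [pbracket_apply, contr_one]

theorem one_pbracket (a : Cochain K g) : pbracket 1 a = 0 := by
  simp [pbracket_apply, contr_one]

/-- An even element acts by a derivation. -/
theorem pbracket_mul_of_even {b : Cochain K g} (hb : b ∈ evenPart K g) (x y : Cochain K g) :
    pbracket b (x * y) = pbracket b x * y + x * pbracket b y := by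
  have hbp := parity_of_even hb
  induction x using ext_induction with
  | halg r =>
    have h0 : pbracket b (algebraMap K (Cochain K g) r) = 0 := by
      simp [pbracket_apply, contr_algebraMap]
    rw [h0]
    simp [← Algebra.smul_def]
  | hadd x z hx hz => simp only [add_mul, map_add, hx, hz]; abel
  | hmul w x hx =>
    rw [mul_assoc, pbracket_odd_mul b (parity_ι w), pbracket_odd_mul b (parity_ι w), hbp, hx]
    simp only [mul_add, add_mul, mul_assoc]
    abel

theorem mul_pbracket_of_even {a b c : Cochain K g} (ha : a ∈ evenPart K g)
    (hb : b ∈ evenPart K g) (hc : c ∈ evenPart K g) :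
    pbracket (a * b) c = a * pbracket b c + pbracket a c * b := by
  rw [pbracket_skew_even (mul_mem_even ha hb), pbracket_mul_of_even hc,
    pbracket_skew_even ha c, pbracket_skew_even hb c]
  simp only [mul_neg, neg_mul]
  abel

/-- An odd element acts by an odd derivation. -/
theorem pbracket_mul_of_odd {b : Cochain K g} (hb : parity b = -b) (x y : Cochain K g) :
    pbracket b (x * y) = pbracket b x * y + parity x * pbracket b y := by
  induction x using ext_induction with
  | halg r =>
    have h0 : pbracket b (algebraMap K (Cochain K g) r) = 0 := by
      simp [pbracket_apply, contr_algebraMap]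
    rw [h0]
    simp [← Algebra.smul_def]
  | hadd x z hx hz => simp only [add_mul, map_add, hx, hz]; abel
  | hmul w x hx =>
    rw [mul_assoc, pbracket_odd_mul b (parity_ι w), pbracket_odd_mul b (parity_ι w), hb]
    simp only [mul_add, add_mul, mul_assoc, map_neg, LinearMap.neg_apply, map_mul, parity_ι,
      hx, mul_neg, neg_mul]
    abel

end Derivation

/-! ## The Grassmann algebra on three conjugate pairs of generators -/

section Grassmann

variable {K : Type*} [Field K] {h : Type*} [AddCommGroup h] [Module K h]
variable (x : Basis (Fin 3) K h)

/-- The Lagrangian subspace of `h* ⊕ h` spanned by `x₁*, x₋₁*, h₀`. -/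
noncomputable def posVec : Fin 3 → Dual K h × h := ![(x.coord 0, 0), (x.coord 1, 0), (0, x 2)]

/-- The complementary Lagrangian subspace spanned by `x₁, x₋₁, h₀*`, in the dual basis. -/
noncomputable def momVec : Fin 3 → Dual K h × h := ![(0, x 0), (0, x 1), (x.coord 2, 0)]

/-- The position generators. -/
noncomputable def pos (i : Fin 3) : Cochain K h := ExteriorAlgebra.ι K (posVec x i)

/-- The momentum generators. -/
noncomputable def mom (i : Fin 3) : Cochain K h := ExteriorAlgebra.ι K (momVec x i)

theorem pairing_pos_pos (i j : Fin 3) : pairing (posVec x i) (posVec x j) = 0 := by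
  fin_cases i <;> fin_cases j <;> simp [pairing_apply, posVec]

theorem pairing_mom_mom (i j : Fin 3) : pairing (momVec x i) (momVec x j) = 0 := by
  fin_cases i <;> fin_cases j <;> simp [pairing_apply, momVec]

theorem pairing_pos_mom (i j : Fin 3) :
    pairing (posVec x i) (momVec x j) = if i = j then 1 else 0 := by
  fin_cases i <;> fin_cases j <;> simp [pairing_apply, posVec, momVec]

theorem pairing_mom_pos (i j : Fin 3) :
    pairing (momVec x i) (posVec x j) = if i = j then 1 else 0 := by
  fin_cases i <;> fin_cases j <;> simp [pairing_apply, posVec, momVec]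

@[simp]
theorem pos_mul_self (i : Fin 3) : pos x i * pos x i = 0 := ExteriorAlgebra.ι_sq_zero _

@[simp]
theorem mom_mul_self (i : Fin 3) : mom x i * mom x i = 0 := ExteriorAlgebra.ι_sq_zero _

@[simp]
theorem pos_mul_self_mul (i : Fin 3) (c : Cochain K h) : pos x i * (pos x i * c) = 0 := by
  rw [← mul_assoc, pos_mul_self, zero_mul]

@[simp]
theorem mom_mul_self_mul (i : Fin 3) (c : Cochain K h) : mom x i * (mom x i * c) = 0 := by
  rw [← mul_assoc, mom_mul_self, zero_mul]

theorem pos_mul_pos (i j : Fin 3) : pos x i * pos x j = -(pos x j * pos x i) :=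
  eq_neg_of_add_eq_zero_left (ExteriorAlgebra.ι_add_mul_swap _ _)

theorem mom_mul_mom (i j : Fin 3) : mom x i * mom x j = -(mom x j * mom x i) :=
  eq_neg_of_add_eq_zero_left (ExteriorAlgebra.ι_add_mul_swap _ _)

@[simp]
theorem mom_mul_pos (i j : Fin 3) : mom x i * pos x j = -(pos x j * mom x i) :=
  eq_neg_of_add_eq_zero_left (ExteriorAlgebra.ι_add_mul_swap _ _)

theorem pos_mul_pos_mul (i j : Fin 3) (c : Cochain K h) :
    pos x i * (pos x j * c) = -(pos x j * (pos x i * c)) := by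
  rw [← mul_assoc, pos_mul_pos, neg_mul, mul_assoc]

theorem mom_mul_mom_mul (i j : Fin 3) (c : Cochain K h) :
    mom x i * (mom x j * c) = -(mom x j * (mom x i * c)) := by
  rw [← mul_assoc, mom_mul_mom, neg_mul, mul_assoc]

@[simp]
theorem mom_mul_pos_mul (i j : Fin 3) (c : Cochain K h) :
    mom x i * (pos x j * c) = -(pos x j * (mom x i * c)) := by
  rw [← mul_assoc, mom_mul_pos, neg_mul, mul_assoc]

-- The strict inequality orients anticommutation, so rewriting sorts indices increasingly and
-- terminates; together with `mom_mul_pos` it puts monomials in normal form with positions before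
-- momenta.
@[simp]
theorem pos_mul_pos_of_lt {i j : Fin 3} (_ : j < i) : pos x i * pos x j = -(pos x j * pos x i) :=
  pos_mul_pos x i j

@[simp]
theorem mom_mul_mom_of_lt {i j : Fin 3} (_ : j < i) : mom x i * mom x j = -(mom x j * mom x i) :=
  mom_mul_mom x i j

@[simp]
theorem pos_mul_pos_mul_of_lt {i j : Fin 3} (_ : j < i) (c : Cochain K h) :
    pos x i * (pos x j * c) = -(pos x j * (pos x i * c)) :=
  pos_mul_pos_mul x i j c

@[simp]
theorem mom_mul_mom_mul_of_lt {i j : Fin 3} (_ : j < i) (c : Cochain K h) :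
    mom x i * (mom x j * c) = -(mom x j * (mom x i * c)) :=
  mom_mul_mom_mul x i j c

@[simp]
theorem contr_pos_pos_mul (i j : Fin 3) (c : Cochain K h) :
    contr (pairing (posVec x i)) (pos x j * c) = -(pos x j * contr (pairing (posVec x i)) c) := by
  rw [pos, contr_ι_mul, pairing_pos_pos, zero_smul, zero_sub]

@[simp]
theorem contr_mom_mom_mul (i j : Fin 3) (c : Cochain K h) :
    contr (pairing (momVec x i)) (mom x j * c) = -(mom x j * contr (pairing (momVec x i)) c) := by
  rw [mom, contr_ι_mul, pairing_mom_mom, zero_smul, zero_sub]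

@[simp]
theorem contr_pos_mom_mul (i j : Fin 3) (c : Cochain K h) :
    contr (pairing (posVec x i)) (mom x j * c) =
      (if i = j then c else 0) - mom x j * contr (pairing (posVec x i)) c := by
  rw [mom, contr_ι_mul, pairing_pos_mom, ite_smul, one_smul, zero_smul]

@[simp]
theorem contr_mom_pos_mul (i j : Fin 3) (c : Cochain K h) :
    contr (pairing (momVec x i)) (pos x j * c) =
      (if i = j then c else 0) - pos x j * contr (pairing (momVec x i)) c := by
  rw [pos, contr_ι_mul, pairing_mom_pos, ite_smul, one_smul, zero_smul]

@[simp]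
theorem contr_pos_pos (i j : Fin 3) : contr (pairing (posVec x i)) (pos x j) = 0 := by
  rw [pos, contr_ι, pairing_pos_pos, map_zero]

@[simp]
theorem contr_mom_mom (i j : Fin 3) : contr (pairing (momVec x i)) (mom x j) = 0 := by
  rw [mom, contr_ι, pairing_mom_mom, map_zero]

@[simp]
theorem contr_pos_mom (i j : Fin 3) :
    contr (pairing (posVec x i)) (mom x j) = if i = j then 1 else 0 := by
  rw [mom, contr_ι, pairing_pos_mom]
  split_ifs <;> simp

@[simp]
theorem contr_mom_pos (i j : Fin 3) :
    contr (pairing (momVec x i)) (pos x j) = if i = j then 1 else 0 := by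
  rw [pos, contr_ι, pairing_mom_pos]
  split_ifs <;> simp

@[simp]
theorem contr_contr (f : Dual K (Dual K h × h)) (c : Cochain K h) : contr f (contr f c) = 0 :=
  CliffordAlgebra.contractLeft_contractLeft f c

@[simp]
theorem parity_pos (i : Fin 3) : parity (pos x i) = -pos x i := parity_ι _

@[simp]
theorem parity_mom (i : Fin 3) : parity (mom x i) = -mom x i := parity_ι _

/-- The Berezin integral, which picks out the coefficient of the top monomial. -/
noncomputable def berezin : Cochain K h →ₗ[K] K :=
  ExteriorAlgebra.algebraMapInv.toLinearMap ∘ₗ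
    contr (pairing (posVec x 2)) ∘ₗ contr (pairing (posVec x 1)) ∘ₗ contr (pairing (posVec x 0)) ∘ₗ
    contr (pairing (momVec x 2)) ∘ₗ contr (pairing (momVec x 1)) ∘ₗ contr (pairing (momVec x 0))

theorem berezin_apply (c : Cochain K h) : berezin x c = ExteriorAlgebra.algebraMapInv
    (contr (pairing (posVec x 2)) (contr (pairing (posVec x 1)) (contr (pairing (posVec x 0))
    (contr (pairing (momVec x 2)) (contr (pairing (momVec x 1))
    (contr (pairing (momVec x 0)) c)))))) := rfl

/-- The integral contracts once with each generator. Contractions anticommute and square to zero, so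
an additional one can be moved next to its copy. -/
theorem berezin_contr_pos (i : Fin 3) (c : Cochain K h) :
    berezin x (contr (pairing (posVec x i)) c) = 0 := by
  rw [berezin_apply]
  fin_cases i <;>
  simp [contr_comm (pairing (momVec x _)) (pairing (posVec x _)),
    contr_comm (pairing (posVec x 1)) (pairing (posVec x 0)),
    contr_comm (pairing (posVec x 2)) (pairing (posVec x 1)),
    contr_comm (pairing (posVec x 2)) (pairing (posVec x 0)), contr_contr]

theorem berezin_contr_mom (i : Fin 3) (c : Cochain K h) :
    berezin x (contr (pairing (momVec x i)) c) = 0 := by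
  rw [berezin_apply]
  fin_cases i <;>
  simp [contr_comm (pairing (momVec x 1)) (pairing (momVec x 0)),
    contr_comm (pairing (momVec x 2)) (pairing (momVec x 1)),
    contr_comm (pairing (momVec x 2)) (pairing (momVec x 0)), contr_contr]

variable [Module.Finite K h]

theorem pbracket_eq_pos_mom (a c : Cochain K h) :
    pbracket a c = ∑ i,
      (parity (contr (pairing (posVec x i)) a) * contr (pairing (momVec x i)) c +
        parity (contr (pairing (momVec x i)) a) * contr (pairing (posVec x i)) c) := by
  have hv (v : h) : formVec v = pairing (K := K) (0, v) := by ext <;> simp [pairing, formDual]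
  have hd (φ : Dual K h) : formDual φ = pairing (φ, 0) := by ext <;> simp [pairing, formVec]
  rw [pbracket_eq x, bracketOf_apply]
  simp only [hv, hd, Fin.sum_univ_three, posVec, momVec, Matrix.cons_val]
  abel

/-- The integral of a bracket vanishes. -/
theorem berezin_pbracket (a c : Cochain K h) : berezin x (pbracket a c) = 0 := by
  -- Integration by parts. Applied to each conjugate pair, it leaves two double contractions of `a`
  -- in opposite orders, which cancel.
  have hparts (f : Dual K (Dual K h × h)) (hf : ∀ c, berezin x (contr f c) = 0)
      (p q : Cochain K h) : berezin x (parity p * contr f q) = -berezin x (contr f p * q) := by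
    have h := hf (p * q)
    rw [contr_mul, map_add] at h
    linear_combination h
  rw [pbracket_eq_pos_mom x, map_sum]
  refine Finset.sum_eq_zero fun i _ => ?_
  rw [map_add, hparts _ (berezin_contr_pos x i), hparts _ (berezin_contr_mom x i),
    contr_comm, neg_mul, map_neg]
  ring

end Grassmann

end BigBracket

namespace BigBracket

/-! ### Quadratic elements and the brackets of the standard representatives. -/

section Grassmann

variable {K : Type*} [Field K] {h : Type*} [AddCommGroup h] [Module K h]
variable (x : Basis (Fin 3) K h)

/-- The top monomial. -/
noncomputable def top : Cochain K h :=
  pos x 0 * (pos x 1 * (pos x 2 * (mom x 0 * (mom x 1 * mom x 2))))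

@[simp]
theorem berezin_top : berezin x (top x) = 1 := by
  simp [berezin_apply, top]

/-- The quadratic element of a matrix. -/
noncomputable def quad : Matrix (Fin 3) (Fin 3) K →ₗ[K] Cochain K h where
  toFun M := ∑ i, ∑ j, M i j • (pos x i * mom x j)
  map_add' M N := by simp [add_smul, Finset.sum_add_distrib]
  map_smul' t M := by simp [Finset.smul_sum, smul_smul]

theorem quad_apply (M : Matrix (Fin 3) (Fin 3) K) :
    quad x M = ∑ i, ∑ j, M i j • (pos x i * mom x j) := rfl

theorem quad_mem_even (M : Matrix (Fin 3) (Fin 3) K) : quad x M ∈ evenPart K h := by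
  rw [quad_apply]
  exact Submodule.sum_mem _ fun _ _ => Submodule.sum_mem _ fun _ _ =>
    Submodule.smul_mem _ _ (ι_mul_ι_mem_even _ _)

theorem quad_one : quad x 1 = ∑ i, pos x i * mom x i := by
  simp [quad_apply, Matrix.one_apply]

/-- Multiplication by `quad x 1` identifies `W ⊗ W*` with `⋀²W ⊗ ⋀²W*`, as in hard Lefschetz. The
diagonal of `N` enters only through sums of two entries, which can be inverted once 2 is invertible.
-/
theorem quad_one_mul_quad (N : Matrix (Fin 3) (Fin 3) K) : quad x 1 * quad x N =
    -(N 0 0 + N 1 1) • (pos x 0 * (pos x 1 * (mom x 0 * mom x 1)))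
    - (N 0 0 + N 2 2) • (pos x 0 * (pos x 2 * (mom x 0 * mom x 2)))
    - (N 1 1 + N 2 2) • (pos x 1 * (pos x 2 * (mom x 1 * mom x 2)))
    - N 0 1 • (pos x 0 * (pos x 2 * (mom x 1 * mom x 2)))
    - N 1 0 • (pos x 1 * (pos x 2 * (mom x 0 * mom x 2)))
    + N 0 2 • (pos x 0 * (pos x 1 * (mom x 1 * mom x 2)))
    + N 2 0 • (pos x 1 * (pos x 2 * (mom x 0 * mom x 1)))
    - N 1 2 • (pos x 0 * (pos x 1 * (mom x 0 * mom x 2)))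
    - N 2 1 • (pos x 0 * (pos x 2 * (mom x 0 * mom x 1))) := by
  rw [quad_one]
  simp only [quad_apply, Fin.sum_univ_three]
  simp [mul_add, add_mul, mul_assoc]
  module

/-- This trace form is the duality between quadratic and quartic elements; all orthogonality
arguments for `M` and `N` rest on it. -/
theorem quad_one_mul_quad_mul_quad (M N : Matrix (Fin 3) (Fin 3) K) :
    quad x 1 * quad x N * quad x M = ((N * M).trace - N.trace * M.trace) • top x := by
  rw [quad_one_mul_quad]
  simp only [quad_apply, Fin.sum_univ_three]
  simp [mul_add, add_mul, sub_mul, mul_assoc, Matrix.trace, Fin.sum_univ_three,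
    Matrix.mul_apply, top]
  module

theorem quad_one_cube : quad x 1 * quad x 1 * quad x 1 = (-6 : K) • top x := by
  rw [quad_one_mul_quad_mul_quad]
  norm_num [Matrix.trace_one]

theorem quad_mul_top (M : Matrix (Fin 3) (Fin 3) K) : quad x M * top x = 0 := by
  simp [quad_apply, top, Fin.sum_univ_three, add_mul, mul_assoc]

theorem berezin_one : berezin x 1 = 0 := by
  simp [berezin_apply]

theorem berezin_quad (M : Matrix (Fin 3) (Fin 3) K) : berezin x (quad x M) = 0 := by
  simp [berezin_apply, quad_apply, Fin.sum_univ_three, contr_mom_pos_mul]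

theorem berezin_quad_one_mul_quad (M : Matrix (Fin 3) (Fin 3) K) :
    berezin x (quad x 1 * quad x M) = 0 := by
  simp [berezin_apply, quad_one_mul_quad, contr_mom_pos_mul]

theorem top_mul_top : top x * top x = 0 := by
  simp [top, mul_assoc]

/-- The representative of an element of `gl(3) ⋉ gl(3)_ab`. -/
noncomputable def repr [CharZero K] :
    Matrix (Fin 3) (Fin 3) K × Matrix (Fin 3) (Fin 3) K →ₗ[K] Cochain K h where
  -- Only traceless `quad` is closed and the square of `quad x 1` is exact, so neither can carry a
  -- trace. The elements `1` and `quad x 1` cubed, which bracket to zero with all terms here, take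
  -- their place.
  toFun P := P.2.trace • (1 : Cochain K h) + quad x (P.2 - (3⁻¹ * P.2.trace) • 1) +
    quad x 1 * quad x P.1 + P.1.trace • (quad x 1 * quad x 1 * quad x 1)
  map_add' P Q := by
    simp only [Prod.fst_add, Prod.snd_add, Matrix.trace_add, map_add, map_sub, map_smul, mul_add]
    module
  map_smul' t P := by
    simp only [Prod.smul_fst, Prod.smul_snd, Matrix.trace_smul, map_sub, map_smul, smul_eq_mul,
      mul_smul_comm, RingHom.id_apply]
    module

theorem repr_apply [CharZero K] (N M : Matrix (Fin 3) (Fin 3) K) :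
    repr x (N, M) = M.trace • (1 : Cochain K h) + quad x (M - (3⁻¹ * M.trace) • 1) +
      quad x 1 * quad x N + N.trace • (quad x 1 * quad x 1 * quad x 1) := rfl

theorem repr_mem_even [CharZero K] (P : Matrix (Fin 3) (Fin 3) K × Matrix (Fin 3) (Fin 3) K) :
    repr x P ∈ evenPart K h :=
  add_mem (add_mem (add_mem (Submodule.smul_mem _ _ one_mem_even) (quad_mem_even x _))
    (mul_mem_even (quad_mem_even x _) (quad_mem_even x _))) (Submodule.smul_mem _ _
    (mul_mem_even (mul_mem_even (quad_mem_even x 1) (quad_mem_even x 1)) (quad_mem_even x 1)))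

variable [Module.Finite K h]

theorem pbracket_quad_pos (M : Matrix (Fin 3) (Fin 3) K) (k : Fin 3) :
    pbracket (quad x M) (pos x k) = ∑ i, M i k • pos x i := by
  rw [pos, pbracket_ι_right, quad_apply]
  simp [contr_pos_pos_mul, map_sum]

theorem pbracket_quad_mom (M : Matrix (Fin 3) (Fin 3) K) (k : Fin 3) :
    pbracket (quad x M) (mom x k) = -∑ j, M k j • mom x j := by
  rw [mom, pbracket_ι_right, quad_apply]
  simp [contr_mom_pos_mul, map_sum]

/-- Bracketing with `quad x M` is a derivation acting by `M` on positions and by the contragredient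
on momenta; expanding the second argument gives the commutator. -/
theorem pbracket_quad_quad (M N : Matrix (Fin 3) (Fin 3) K) :
    pbracket (quad x M) (quad x N) = quad x (M * N - N * M) := by
  conv_lhs => rw [quad_apply x N]
  simp only [map_sum, map_smul, pbracket_mul_of_even (quad_mem_even x M), pbracket_quad_pos,
    pbracket_quad_mom]
  simp only [quad_apply, Fin.sum_univ_three, Matrix.sub_apply, Matrix.mul_apply]
  simp only [mul_add, add_mul, mul_neg, smul_mul_assoc, mul_smul_comm]
  module

theorem pbracket_quad_quad_one (M : Matrix (Fin 3) (Fin 3) K) :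
    pbracket (quad x M) (quad x 1) = 0 := by
  rw [pbracket_quad_quad, mul_one, one_mul, sub_self, map_zero]

theorem pbracket_quad_quad_one_mul (M N : Matrix (Fin 3) (Fin 3) K) :
    pbracket (quad x M) (quad x 1 * quad x N) = quad x 1 * quad x (M * N - N * M) := by
  rw [pbracket_mul_of_even (quad_mem_even x M), pbracket_quad_quad_one, pbracket_quad_quad,
    zero_mul, zero_add]

theorem pbracket_quad_cube (M : Matrix (Fin 3) (Fin 3) K) :
    pbracket (quad x M) (quad x 1 * quad x 1 * quad x 1) = 0 := by
  simp [pbracket_mul_of_even (quad_mem_even x M), pbracket_quad_quad_one]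

theorem pbracket_quad_one_mul_quad_cube (M : Matrix (Fin 3) (Fin 3) K) :
    pbracket (quad x 1 * quad x M) (quad x 1 * quad x 1 * quad x 1) = 0 := by
  rw [mul_pbracket_of_even (quad_mem_even x 1) (quad_mem_even x M)
    (mul_mem_even (mul_mem_even (quad_mem_even x 1) (quad_mem_even x 1)) (quad_mem_even x 1)),
    pbracket_quad_cube, pbracket_quad_cube, mul_zero, zero_mul, add_zero]

theorem trace_mul_sub_mul (M N : Matrix (Fin 3) (Fin 3) K) : (M * N - N * M).trace = 0 := by
  rw [Matrix.trace_sub, Matrix.trace_mul_comm, sub_self]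

/-- Since `quad x 1` commutes with every `quad`, only `e * e * quad [M, N]` remains. This is a
multiple of `tr [M, N]` times the top monomial, hence zero. -/
theorem pbracket_quad_one_mul_quad (M N : Matrix (Fin 3) (Fin 3) K) :
    pbracket (quad x 1 * quad x M) (quad x 1 * quad x N) = 0 := by
  rw [mul_pbracket_of_even (quad_mem_even x 1) (quad_mem_even x M)
    (mul_mem_even (quad_mem_even x 1) (quad_mem_even x N)), pbracket_quad_quad_one_mul,
    pbracket_quad_quad_one_mul, one_mul, mul_one, sub_self, map_zero, mul_zero, zero_mul, add_zero,
    ← mul_assoc, quad_one_mul_quad_mul_quad, one_mul, trace_mul_sub_mul, mul_zero, sub_zero,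
    zero_smul]

/-- The brackets close on cochains without coboundary corrections. Scalar parts of the matrices drop
out of commutators, and the trace terms on the right vanish because commutators are traceless. -/
theorem pbracket_repr [CharZero K] (N M N' M' : Matrix (Fin 3) (Fin 3) K) :
    pbracket (repr x (N, M)) (repr x (N', M')) =
      repr x ((M * N' - N' * M) - (M' * N - N * M'), M * M' - M' * M) := by
  have he := quad_mem_even x (1 : Matrix (Fin 3) (Fin 3) K)
  have hcube := mul_mem_even (mul_mem_even he he) he
  have h1 (X : Matrix (Fin 3) (Fin 3) K) :
      pbracket (quad x 1 * quad x 1 * quad x 1) (quad x X) = 0 := by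
    rw [pbracket_skew_even hcube, pbracket_quad_cube, neg_zero]
  have h2 (X : Matrix (Fin 3) (Fin 3) K) :
      pbracket (quad x 1 * quad x 1 * quad x 1) (quad x 1 * quad x X) = 0 := by
    rw [pbracket_skew_even hcube, pbracket_quad_one_mul_quad_cube, neg_zero]
  have h3 : pbracket (quad x 1 * quad x 1 * quad x 1) (quad x 1 * quad x 1 * quad x 1) = 0 := by
    simp [pbracket_mul_of_even hcube, h1]
  have h4 (X Y : Matrix (Fin 3) (Fin 3) K) :
      pbracket (quad x 1 * quad x X) (quad x Y) = -(quad x 1 * quad x (Y * X - X * Y)) := by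
    rw [pbracket_skew_even (mul_mem_even he (quad_mem_even x X)), pbracket_quad_quad_one_mul]
  have h5 (s t : K) (X Y : Matrix (Fin 3) (Fin 3) K) :
      (X - s • 1) * (Y - t • 1) - (Y - t • 1) * (X - s • 1) = X * Y - Y * X := by
    simp only [sub_mul, mul_sub, smul_mul_assoc, mul_smul_comm, one_mul, mul_one]
    module
  have h6 (s : K) (X Y : Matrix (Fin 3) (Fin 3) K) :
      (X - s • 1) * Y - Y * (X - s • 1) = X * Y - Y * X := by
    simp only [sub_mul, mul_sub, smul_mul_assoc, mul_smul_comm, one_mul, mul_one]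
    module
  have h7 : ((M * N' - N' * M) - (M' * N - N * M')).trace = 0 := by
    rw [Matrix.trace_sub, trace_mul_sub_mul, trace_mul_sub_mul, sub_self]
  rw [repr_apply, repr_apply, repr_apply, h7, trace_mul_sub_mul]
  simp only [map_add, map_smul, LinearMap.add_apply, LinearMap.smul_apply, pbracket_one,
    one_pbracket, pbracket_quad_quad, pbracket_quad_cube, pbracket_quad_quad_one_mul,
    pbracket_quad_one_mul_quad_cube, pbracket_quad_one_mul_quad, h1, h2, h3, h4, h5, h6]
  simp only [mul_zero, zero_smul, smul_zero, sub_zero, add_zero, zero_add, map_sub, mul_sub]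
  abel

end Grassmann

end BigBracket

namespace BigBracket

/-! ## The spanning set of the even part -/

section Span

variable {K : Type*} [Field K] {h : Type*} [AddCommGroup h] [Module K h]
variable (x : Basis (Fin 3) K h)

/-- Even combinations of three anticommuting generators. -/
noncomputable def evenComb (θ : Fin 3 → Cochain K h) (a : Fin 4 → K) : Cochain K h :=
  a 0 • 1 + a 1 • (θ 1 * θ 2) + a 2 • (θ 0 * θ 2) + a 3 • (θ 0 * θ 1)

/-- Odd combinations of three anticommuting generators. -/
noncomputable def oddComb (θ : Fin 3 → Cochain K h) (a : Fin 4 → K) : Cochain K h :=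
  a 0 • θ 0 + a 1 • θ 1 + a 2 • θ 2 + a 3 • (θ 0 * (θ 1 * θ 2))

theorem pos_mul_evenComb (i : Fin 3) (a : Fin 4 → K) :
    ∃ b, pos x i * evenComb (pos x) a = oddComb (pos x) b := by
  fin_cases i
  · exact ⟨![a 0, 0, 0, a 1], by simp [evenComb, oddComb, mul_add]⟩
  · exact ⟨![0, a 0, 0, -a 2], by simp [evenComb, oddComb, mul_add]⟩
  · exact ⟨![0, 0, a 0, a 3], by simp [evenComb, oddComb, mul_add]⟩

theorem pos_mul_oddComb (i : Fin 3) (a : Fin 4 → K) :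
    ∃ b, pos x i * oddComb (pos x) a = evenComb (pos x) b := by
  fin_cases i
  · exact ⟨![0, 0, a 2, a 1], by simp [evenComb, oddComb, mul_add]; abel⟩
  · exact ⟨![0, a 2, 0, -a 0], by simp [evenComb, oddComb, mul_add]; abel⟩
  · exact ⟨![0, -a 1, -a 0, 0], by simp [evenComb, oddComb, mul_add]; abel⟩

theorem mom_mul_evenComb (i : Fin 3) (a : Fin 4 → K) :
    ∃ b, mom x i * evenComb (mom x) a = oddComb (mom x) b := by
  fin_cases i
  · exact ⟨![a 0, 0, 0, a 1], by simp [evenComb, oddComb, mul_add]⟩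
  · exact ⟨![0, a 0, 0, -a 2], by simp [evenComb, oddComb, mul_add]⟩
  · exact ⟨![0, 0, a 0, a 3], by simp [evenComb, oddComb, mul_add]⟩

theorem mom_mul_oddComb (i : Fin 3) (a : Fin 4 → K) :
    ∃ b, mom x i * oddComb (mom x) a = evenComb (mom x) b := by
  fin_cases i
  · exact ⟨![0, 0, a 2, a 1], by simp [evenComb, oddComb, mul_add]; abel⟩
  · exact ⟨![0, a 2, 0, -a 0], by simp [evenComb, oddComb, mul_add]; abel⟩
  · exact ⟨![0, -a 1, -a 0, 0], by simp [evenComb, oddComb, mul_add]; abel⟩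

theorem mom_mul_evenComb_pos (i : Fin 3) (a : Fin 4 → K) :
    mom x i * evenComb (pos x) a = evenComb (pos x) a * mom x i := by
  simp [evenComb, mul_add, add_mul, mul_assoc]

theorem mom_mul_oddComb_pos (i : Fin 3) (a : Fin 4 → K) :
    mom x i * oddComb (pos x) a = -(oddComb (pos x) a * mom x i) := by
  simp [oddComb, mul_add, add_mul, mul_assoc]
  abel

/-- The span of the even monomials. -/
noncomputable def evenSpan : Submodule K (Cochain K h) :=
  Submodule.span K ({z | ∃ a b, z = evenComb (pos x) a * evenComb (mom x) b} ∪
    {z | ∃ a b, z = oddComb (pos x) a * oddComb (mom x) b})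

/-- The span of the odd monomials. -/
noncomputable def oddSpan : Submodule K (Cochain K h) :=
  Submodule.span K ({z | ∃ a b, z = oddComb (pos x) a * evenComb (mom x) b} ∪
    {z | ∃ a b, z = evenComb (pos x) a * oddComb (mom x) b})

/-- The generators span `h* ⊕ h`. -/
theorem span_posVec_momVec :
    Submodule.span K (Set.range (posVec x) ∪ Set.range (momVec x)) = ⊤ := by
  rw [eq_top_iff]
  rintro ⟨φ, v⟩ -
  have hp (i : Fin 3) : posVec x i ∈
      Submodule.span K (Set.range (posVec x) ∪ Set.range (momVec x)) :=
    Submodule.subset_span (Or.inl ⟨i, rfl⟩)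
  have hm (i : Fin 3) : momVec x i ∈
      Submodule.span K (Set.range (posVec x) ∪ Set.range (momVec x)) :=
    Submodule.subset_span (Or.inr ⟨i, rfl⟩)
  have hφ : φ = φ (x 0) • x.coord 0 + φ (x 1) • x.coord 1 + φ (x 2) • x.coord 2 := by
    refine x.ext fun i => ?_
    fin_cases i <;> simp
  have hv : v = x.coord 0 v • x 0 + x.coord 1 v • x 1 + x.coord 2 v • x 2 := by
    conv_lhs => rw [← x.sum_repr v, Fin.sum_univ_three]
    rfl
  have key : ((φ, v) : Dual K h × h) = φ (x 0) • posVec x 0 + φ (x 1) • posVec x 1 +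
      x.coord 2 v • posVec x 2 + x.coord 0 v • momVec x 0 + x.coord 1 v • momVec x 1 +
      φ (x 2) • momVec x 2 := by
    refine Prod.ext ?_ ?_
    · conv_lhs => rw [hφ]
      simp [posVec, momVec]
    · conv_lhs => rw [hv]
      simp [posVec, momVec]
      abel
  rw [key]
  exact add_mem (add_mem (add_mem (add_mem (add_mem (Submodule.smul_mem _ _ (hp _))
    (Submodule.smul_mem _ _ (hp _))) (Submodule.smul_mem _ _ (hp _)))
    (Submodule.smul_mem _ _ (hm _))) (Submodule.smul_mem _ _ (hm _)))
    (Submodule.smul_mem _ _ (hm _))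

theorem ι_mul_mem_of_generators {E O : Submodule K (Cochain K h)}
    (hpos : ∀ i, ∀ z ∈ E, pos x i * z ∈ O) (hmom : ∀ i, ∀ z ∈ E, mom x i * z ∈ O)
    (v : Dual K h × h) {z : Cochain K h} (hz : z ∈ E) : ExteriorAlgebra.ι K v * z ∈ O := by
  have hv : v ∈ Submodule.span K (Set.range (posVec x) ∪ Set.range (momVec x)) := by
    rw [span_posVec_momVec]; trivial
  induction hv using Submodule.span_induction with
  | mem v hv =>
    rcases hv with ⟨i, rfl⟩ | ⟨i, rfl⟩
    · exact hpos i z hz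
    · exact hmom i z hz
  | zero => simp
  | add v v' _ _ h1 h2 => rw [map_add, add_mul]; exact add_mem h1 h2
  | smul t v _ h1 => rw [map_smul, smul_mul_assoc]; exact Submodule.smul_mem _ _ h1

theorem mul_span_le (c : Cochain K h) {S : Set (Cochain K h)} {O : Submodule K (Cochain K h)}
    (hS : ∀ z ∈ S, c * z ∈ O) : ∀ z ∈ Submodule.span K S, c * z ∈ O := by
  intro z hz
  have : Submodule.span K S ≤ O.comap (LinearMap.mulLeft K c) := Submodule.span_le.2 hS
  exact this hz

theorem ι_mul_evenSpan (v : Dual K h × h) {z : Cochain K h} (hz : z ∈ evenSpan x) :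
    ExteriorAlgebra.ι K v * z ∈ oddSpan x := by
  refine ι_mul_mem_of_generators x (fun i => mul_span_le _ ?_) (fun i => mul_span_le _ ?_) v hz
  · rintro _ (⟨a, b, rfl⟩ | ⟨a, b, rfl⟩)
    · obtain ⟨c, hc⟩ := pos_mul_evenComb x i a
      exact Submodule.subset_span (Or.inl ⟨c, b, by rw [← mul_assoc, hc]⟩)
    · obtain ⟨c, hc⟩ := pos_mul_oddComb x i a
      exact Submodule.subset_span (Or.inr ⟨c, b, by rw [← mul_assoc, hc]⟩)
  · rintro _ (⟨a, b, rfl⟩ | ⟨a, b, rfl⟩)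
    · obtain ⟨c, hc⟩ := mom_mul_evenComb x i b
      exact Submodule.subset_span (Or.inr ⟨a, c, by
        rw [← mul_assoc, mom_mul_evenComb_pos, mul_assoc, hc]⟩)
    · obtain ⟨c, hc⟩ := mom_mul_oddComb x i b
      rw [← mul_assoc, mom_mul_oddComb_pos, neg_mul, mul_assoc, hc]
      exact neg_mem (Submodule.subset_span (Or.inl ⟨a, c, rfl⟩))

theorem ι_mul_oddSpan (v : Dual K h × h) {z : Cochain K h} (hz : z ∈ oddSpan x) :
    ExteriorAlgebra.ι K v * z ∈ evenSpan x := by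
  refine ι_mul_mem_of_generators x (fun i => mul_span_le _ ?_) (fun i => mul_span_le _ ?_) v hz
  · rintro _ (⟨a, b, rfl⟩ | ⟨a, b, rfl⟩)
    · obtain ⟨c, hc⟩ := pos_mul_oddComb x i a
      exact Submodule.subset_span (Or.inl ⟨c, b, by rw [← mul_assoc, hc]⟩)
    · obtain ⟨c, hc⟩ := pos_mul_evenComb x i a
      exact Submodule.subset_span (Or.inr ⟨c, b, by rw [← mul_assoc, hc]⟩)
  · rintro _ (⟨a, b, rfl⟩ | ⟨a, b, rfl⟩)
    · obtain ⟨c, hc⟩ := mom_mul_evenComb x i b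
      rw [← mul_assoc, mom_mul_oddComb_pos, neg_mul, mul_assoc, hc]
      exact neg_mem (Submodule.subset_span (Or.inr ⟨a, c, rfl⟩))
    · obtain ⟨c, hc⟩ := mom_mul_oddComb x i b
      exact Submodule.subset_span (Or.inl ⟨a, c, by
        rw [← mul_assoc, mom_mul_evenComb_pos, mul_assoc, hc]⟩)

/-- Even elements arise from scalars by multiplying with two vectors at a time, and each
multiplication exchanges `evenSpan` and `oddSpan`. -/
theorem evenPart_le_evenSpan : evenPart K h ≤ evenSpan x := by
  intro z hz
  refine CliffordAlgebra.even_induction (0 : QuadraticForm K (Dual K h × h))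
    (motive := fun z _ => z ∈ evenSpan x) ?_ ?_ ?_ z hz
  · intro r
    refine Submodule.subset_span (Or.inl ⟨![r, 0, 0, 0], ![1, 0, 0, 0], ?_⟩)
    simp [evenComb, Algebra.algebraMap_eq_smul_one]
  · intro a b _ _ ha hb
    exact add_mem ha hb
  · intro v v' z _ hz
    rw [mul_assoc]
    exact ι_mul_oddSpan x v (ι_mul_evenSpan x v' hz)

/-- The even cochains that are exact for the Heisenberg differential, together with those whose
coefficients are detected by exact cochains. -/
noncomputable def acyclicPart (α β γ δ : Fin 3 → K) : Cochain K h :=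
  (α 0 • (mom x 1 * mom x 2) + α 1 • (mom x 0 * mom x 2) + α 2 • (mom x 0 * mom x 1)) +
  (β 0 • (pos x 0 * (mom x 0 * (mom x 1 * mom x 2))) +
    β 1 • (pos x 1 * (mom x 0 * (mom x 1 * mom x 2))) +
    β 2 • (pos x 2 * (mom x 0 * (mom x 1 * mom x 2)))) +
  (γ 0 • (pos x 1 * pos x 2) + γ 1 • (pos x 0 * pos x 2) + γ 2 • (pos x 0 * pos x 1)) +
  (δ 0 • (pos x 0 * (pos x 1 * (pos x 2 * mom x 0))) +
    δ 1 • (pos x 0 * (pos x 1 * (pos x 2 * mom x 1))) +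
    δ 2 • (pos x 0 * (pos x 1 * (pos x 2 * mom x 2))))

/-- The even monomials are sorted by their numbers of positions and momenta: (0,0), (1,1), (2,2) and
(3,3) give `s`, `M`, `N`, `t`; the degrees (0,2), (1,3), (2,0), (3,1) give `α`, `β`, `γ`, `δ`. -/
theorem exists_decomposition [CharZero K] {z : Cochain K h} (hz : z ∈ evenPart K h) :
    ∃ (s t : K) (M N : Matrix (Fin 3) (Fin 3) K) (α β γ δ : Fin 3 → K),
      z = acyclicPart x α β γ δ + s • (1 : Cochain K h) + quad x M + quad x 1 * quad x N +
        t • top x := by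
  refine Submodule.span_induction (p := fun z _ => ∃ (s t : K) (M N : Matrix (Fin 3) (Fin 3) K)
    (α β γ δ : Fin 3 → K), z = acyclicPart x α β γ δ + s • (1 : Cochain K h) + quad x M +
      quad x 1 * quad x N + t • top x) ?_ ?_ ?_ ?_ (evenPart_le_evenSpan x hz)
  · rintro _ (⟨a, b, rfl⟩ | ⟨a, b, rfl⟩)
    · refine ⟨a 0 * b 0, 0, 0,
        -- The inverse of the formula `quad_one_mul_quad`; the diagonal solves three equations for
        -- sums of two unknowns, hence the halves.
        !![-(a 3 * b 3 + a 2 * b 2 - a 1 * b 1) / 2, -(a 2 * b 1), a 3 * b 1;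
          -(a 1 * b 2), -(a 3 * b 3 + a 1 * b 1 - a 2 * b 2) / 2, -(a 3 * b 2);
          a 1 * b 3, -(a 2 * b 3), -(a 2 * b 2 + a 1 * b 1 - a 3 * b 3) / 2],
        ![a 0 * b 1, a 0 * b 2, a 0 * b 3], 0, ![a 1 * b 0, a 2 * b 0, a 3 * b 0], 0, ?_⟩
      rw [quad_one_mul_quad]
      simp only [evenComb, acyclicPart, map_zero, zero_smul, Pi.zero_apply, mul_add, add_mul,
        smul_mul_assoc, mul_smul_comm, mul_assoc, one_mul, mul_one, Matrix.of_apply,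
        Matrix.cons_val]
      module
    · refine ⟨0, a 3 * b 3,
        !![a 0 * b 0, a 0 * b 1, a 0 * b 2; a 1 * b 0, a 1 * b 1, a 1 * b 2;
          a 2 * b 0, a 2 * b 1, a 2 * b 2], 0, 0, ![a 0 * b 3, a 1 * b 3, a 2 * b 3], 0,
        ![a 3 * b 0, a 3 * b 1, a 3 * b 2], ?_⟩
      simp only [oddComb, acyclicPart, map_zero, zero_smul, Pi.zero_apply, mul_add, add_mul,
        smul_mul_assoc, mul_smul_comm, mul_assoc, Matrix.of_apply, top,
        Matrix.cons_val, mul_zero, quad_apply, Fin.sum_univ_three]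
      module
  · exact ⟨0, 0, 0, 0, 0, 0, 0, 0, by simp [acyclicPart]⟩
  · rintro _ _ _ _ ⟨s, t, M, N, α, β, γ, δ, rfl⟩ ⟨s', t', M', N', α', β', γ', δ', rfl⟩
    refine ⟨s + s', t + t', M + M', N + N', α + α', β + β', γ + γ', δ + δ', ?_⟩
    simp only [acyclicPart, map_add, mul_add, Pi.add_apply]
    module
  · rintro r _ _ ⟨s, t, M, N, α, β, γ, δ, rfl⟩
    refine ⟨r * s, r * t, r • M, r • N, r • α, r • β, r • γ, r • δ, ?_⟩
    simp only [acyclicPart, map_smul, mul_smul_comm, Pi.smul_apply, smul_eq_mul]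
    module

end Span

end BigBracket

namespace BigBracket

/-! ## The Heisenberg differential -/

section Heisenberg

theorem diff_one (K : Type*) [Field K] (g : Type*) [LieRing g] [LieAlgebra K g]
    [Module.Finite K g] [CharZero K] : diff K g 1 = 0 := pbracket_one _

variable {K : Type*} [Field K] [CharZero K] {h : Type*} [LieRing h] [LieAlgebra K h]
  [Module.Finite K h] {x : Basis (Fin 3) K h}

/-- The reason for the choice of positions: the structure tensor is their product. The factor `1/2`
cancels against the two equal terms from `⁅x 0, x 1⁆` and `⁅x 1, x 0⁆`. -/
theorem mu_eq_pos (hx : IsHeisenbergBasis x) : mu K h = pos x 0 * (pos x 1 * pos x 2) := by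
  have h10 : ⁅x 1, x 0⁆ = -x 2 := by rw [← lie_skew, hx.lie_zero_one]
  have h20 : ⁅x 2, x 0⁆ = 0 := by rw [← lie_skew, hx.lie_zero_two, neg_zero]
  have h21 : ⁅x 2, x 1⁆ = 0 := by rw [← lie_skew, hx.lie_one_two, neg_zero]
  have e0 : inDual (x.coord 0) = pos x 0 := rfl
  have e1 : inDual (x.coord 1) = pos x 1 := rfl
  have e2 : inVec (K := K) (x 2) = pos x 2 := rfl
  rw [mu_eq x]
  simp only [Fin.sum_univ_three, lie_self, hx.lie_zero_one, hx.lie_zero_two, hx.lie_one_two, h10,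
    h20, h21, map_zero, map_neg, e0, e1, e2, mul_zero, zero_add, add_zero, mul_neg,
    mul_assoc]
  rw [pos_mul_pos_mul x 1 0, neg_neg]
  rw [← two_smul K, smul_smul, inv_mul_cancel₀ two_ne_zero, one_smul]

theorem diff_mul (hx : IsHeisenbergBasis x) (a b : Cochain K h) :
    diff K h (a * b) = diff K h a * b + parity a * diff K h b := by
  refine pbracket_mul_of_odd ?_ a b
  simp [mu_eq_pos hx]

theorem diff_even_mul (hx : IsHeisenbergBasis x) {a : Cochain K h} (ha : a ∈ evenPart K h)
    (b : Cochain K h) :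
    diff K h (a * b) = diff K h a * b + a * diff K h b := by
  rw [diff_mul hx, parity_of_even ha]

theorem diff_pos (hx : IsHeisenbergBasis x) (i : Fin 3) : diff K h (pos x i) = 0 := by
  rw [diff, pos, pbracket_ι_right, mu_eq_pos hx]
  simp [contr_pos_pos_mul]

theorem diff_mom_zero (hx : IsHeisenbergBasis x) : diff K h (mom x 0) = pos x 1 * pos x 2 := by
  rw [diff, mom, pbracket_ι_right, mu_eq_pos hx]
  simp [contr_mom_pos_mul]

theorem diff_mom_one (hx : IsHeisenbergBasis x) : diff K h (mom x 1) = -(pos x 0 * pos x 2) := by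
  rw [diff, mom, pbracket_ι_right, mu_eq_pos hx]
  simp [contr_mom_pos_mul]

theorem diff_mom_two (hx : IsHeisenbergBasis x) : diff K h (mom x 2) = pos x 0 * pos x 1 := by
  rw [diff, mom, pbracket_ι_right, mu_eq_pos hx]
  simp [contr_mom_pos_mul]

theorem diff_quad (hx : IsHeisenbergBasis x) (M : Matrix (Fin 3) (Fin 3) K) :
    diff K h (quad x M) = -M.trace • (pos x 0 * (pos x 1 * pos x 2)) := by
  simp only [quad_apply, Fin.sum_univ_three, map_add, map_smul, diff_mul hx, diff_pos hx,
    diff_mom_zero hx, diff_mom_one hx, diff_mom_two hx, Matrix.trace, Matrix.diag]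
  simp
  module

/-- The differential of a quadratic element is a multiple of the product of all three positions,
which any further position annihilates. -/
theorem diff_quad_mul_quad (hx : IsHeisenbergBasis x) (M N : Matrix (Fin 3) (Fin 3) K) :
    diff K h (quad x M * quad x N) = 0 := by
  have hz (P : Matrix (Fin 3) (Fin 3) K) :
      pos x 0 * (pos x 1 * pos x 2) * quad x P = 0 ∧
      quad x P * (pos x 0 * (pos x 1 * pos x 2)) = 0 := by
    constructor <;> simp [quad_apply, Fin.sum_univ_three, mul_add, add_mul, mul_assoc]
  rw [diff_even_mul hx (quad_mem_even x M), diff_quad hx, diff_quad hx, smul_mul_assoc,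
    mul_smul_comm, (hz N).1, (hz M).2, smul_zero, smul_zero, add_zero]

theorem diff_cube (hx : IsHeisenbergBasis x) : diff K h (quad x 1 * quad x 1 * quad x 1) = 0 := by
  rw [diff_even_mul hx (mul_mem_even (quad_mem_even x 1) (quad_mem_even x 1)),
    diff_quad_mul_quad hx, diff_quad hx, zero_mul, zero_add, quad_one_mul_quad]
  simp [sub_mul, mul_assoc]

theorem diff_repr (hx : IsHeisenbergBasis x)
    (P : Matrix (Fin 3) (Fin 3) K × Matrix (Fin 3) (Fin 3) K) :
    diff K h (repr x P) = 0 := by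
  obtain ⟨N, M⟩ := P
  have htr : (M - (3⁻¹ * M.trace) • (1 : Matrix (Fin 3) (Fin 3) K)).trace = 0 := by
    simp [Matrix.trace_one, mul_comm]
  rw [repr_apply, map_add, map_add, map_add, map_smul, map_smul, diff_one, diff_cube hx,
    diff_quad_mul_quad hx, diff_quad hx, htr]
  simp

/-- This makes `quad x 1 * quad x 1` exact: the scalar direction of `N` is lost in `e * quad N`.
Dually, it forces `tr M = 0` for cocycles. -/
theorem diff_mom_mul_mom_mul_mom (hx : IsHeisenbergBasis x) :
    diff K h (mom x 0 * (mom x 1 * mom x 2)) = (-2⁻¹ : K) • (quad x 1 * quad x 1) := by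
  rw [quad_one_mul_quad]
  simp [diff_mul hx, diff_mom_zero hx, diff_mom_one hx, diff_mom_two hx, mul_add,
    mul_assoc]
  module

/-- These coboundaries both absorb the `δ` terms and detect the `α` terms, which are complementary
to them under the integral. -/
theorem diff_pos_mul_mom_mul_mom (hx : IsHeisenbergBasis x) (i : Fin 3) :
    ∃ c, diff K h c = pos x 0 * (pos x 1 * (pos x 2 * mom x i)) := by
  fin_cases i
  · refine ⟨pos x 2 * (mom x 0 * mom x 2), ?_⟩
    simp [diff_mul hx, diff_pos hx, diff_mom_zero hx, diff_mom_two hx, mul_add, mul_assoc]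
  · refine ⟨-(pos x 0 * (mom x 0 * mom x 1)), ?_⟩
    simp [diff_mul hx, diff_pos hx, diff_mom_zero hx, diff_mom_one hx, mul_add, mul_assoc]
  · refine ⟨-(pos x 0 * (mom x 0 * mom x 2)), ?_⟩
    simp [diff_mul hx, diff_pos hx, diff_mom_zero hx, diff_mom_two hx, mul_add, mul_assoc]

/-- Even cocycles are orthogonal to coboundaries. -/
theorem berezin_mul_diff (hx : IsHeisenbergBasis x) {z : Cochain K h} (hz : z ∈ evenPart K h)
    (hd : diff K h z = 0)
    (c : Cochain K h) : berezin x (z * diff K h c) = 0 := by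
  have h1 := diff_even_mul hx hz c
  rw [hd, zero_mul, zero_add] at h1
  rw [← h1]
  exact berezin_pbracket x _ _

/-- Every even cocycle is cohomologous to a standard representative. -/
theorem exists_repr_add_diff (hx : IsHeisenbergBasis x) {z : Cochain K h} (hz : z ∈ evenPart K h)
    (hd : diff K h z = 0) :
    ∃ P c, z = repr x P + diff K h c := by
  obtain ⟨s, t, M, N, α, β, γ, δ, rfl⟩ := exists_decomposition x hz
  have horth := berezin_mul_diff hx hz hd
  obtain ⟨c₀, hc₀⟩ := diff_pos_mul_mom_mul_mom hx 0
  obtain ⟨c₁, hc₁⟩ := diff_pos_mul_mom_mul_mom hx 1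
  obtain ⟨c₂, hc₂⟩ := diff_pos_mul_mom_mul_mom hx 2
  have hα : α = 0 := by
    have h0 := horth c₀
    have h1 := horth c₁
    have h2 := horth c₂
    rw [hc₀, quad_one_mul_quad] at h0
    rw [hc₁, quad_one_mul_quad] at h1
    rw [hc₂, quad_one_mul_quad] at h2
    simp [acyclicPart, quad_apply, Fin.sum_univ_three, add_mul, sub_mul, mul_assoc, top,
      berezin_apply, contr_mom_pos_mul, contr_pos_mom_mul] at h0 h1 h2
    ext i
    fin_cases i
    exacts [h0, h1, h2]
  -- The differentials of the momenta are the products of two positions, complementary to the `β`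
  -- monomials.
  have hβ : β = 0 := by
    have h0 := horth (mom x 0)
    have h1 := horth (mom x 1)
    have h2 := horth (mom x 2)
    rw [diff_mom_zero hx, quad_one_mul_quad] at h0
    rw [diff_mom_one hx, quad_one_mul_quad] at h1
    rw [diff_mom_two hx, quad_one_mul_quad] at h2
    simp [acyclicPart, quad_apply, Fin.sum_univ_three, add_mul, sub_mul, mul_assoc, top,
      berezin_apply, contr_mom_pos_mul, contr_pos_mom_mul] at h0 h1 h2
    ext i
    fin_cases i
    exacts [h0, h1, h2]
  -- The coboundary used is `-e²/2`; its integral against `quad x M` is `-(tr M - 3 tr M)/2 = tr M`.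
  have hM : M.trace = 0 := by
    have h0 := horth (mom x 0 * (mom x 1 * mom x 2))
    rw [diff_mom_mul_mom_mul_mom hx, quad_one_mul_quad, quad_one_mul_quad] at h0
    simp [acyclicPart, quad_apply, Fin.sum_univ_three, add_mul, sub_mul, mul_add, mul_sub,
      mul_assoc, top, berezin_apply, contr_mom_pos_mul, contr_pos_mom_mul] at h0
    rw [Matrix.trace, Fin.sum_univ_three]
    change M 0 0 + M 1 1 + M 2 2 = 0
    linear_combination h0
  subst hα hβ
  -- Since `e³ = -6 • top`, the trace of the corrected `N` must be `-t/6`. Adding `a • 1` to `N`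
  -- creates `a • e²`, which the term `2a • (mom 0 mom 1 mom 2)` of the primitive cancels.
  let a : K := (-(t / 6) - N.trace) / 3
  refine ⟨(N + a • 1, M + (s / 3) • 1), γ 0 • mom x 0 - γ 1 • mom x 1 + γ 2 • mom x 2 +
    δ 0 • c₀ + δ 1 • c₁ + δ 2 • c₂ + (2 * a) • (mom x 0 * (mom x 1 * mom x 2)), ?_⟩
  have htrN : (N + a • (1 : Matrix (Fin 3) (Fin 3) K)).trace = -(t / 6) := by
    simp only [Matrix.trace_add, Matrix.trace_smul, Matrix.trace_one, Fintype.card_fin, smul_eq_mul,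
      a]
    push_cast
    ring
  have htrM : (M + (s / 3) • (1 : Matrix (Fin 3) (Fin 3) K)).trace = s := by
    simp only [Matrix.trace_add, Matrix.trace_smul, Matrix.trace_one, Fintype.card_fin, smul_eq_mul,
      hM]
    push_cast
    ring
  rw [repr_apply, htrN, htrM, quad_one_cube]
  simp only [map_add, map_sub, map_smul, diff_mom_zero hx, diff_mom_one hx, diff_mom_two hx, hc₀,
    hc₁, hc₂, diff_mom_mul_mom_mul_mom hx, mul_add, mul_smul_comm, acyclicPart, Pi.zero_apply]
  module

/-- A standard representative which is a coboundary vanishes. -/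
theorem repr_eq_zero_of_exact (hx : IsHeisenbergBasis x)
    {P : Matrix (Fin 3) (Fin 3) K × Matrix (Fin 3) (Fin 3) K}
    {c : Cochain K h} (hc : diff K h c = repr x P) : P = 0 := by
  obtain ⟨N, M⟩ := P
  have horth (y : Cochain K h) (hy : y ∈ evenPart K h) (hd : diff K h y = 0) :
      berezin x (y * repr x (N, M)) = 0 := by
    rw [← hc]
    exact berezin_mul_diff hx hy hd c
  have he := quad_mem_even x (1 : Matrix (Fin 3) (Fin 3) K)
  have hcube := mul_mem_even (mul_mem_even he he) he
  have h6 : (-6 : K) ≠ 0 := by norm_num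
  have hquad (Q R : Matrix (Fin 3) (Fin 3) K) :
      quad x 1 * quad x Q * (quad x 1 * quad x R) = 0 := by
    rw [← mul_assoc, quad_one_mul_quad_mul_quad, smul_mul_assoc,
      ← even_mul_comm (quad_mem_even x R), quad_mul_top x, smul_zero]
  have htop (Q : Matrix (Fin 3) (Fin 3) K) : top x * quad x Q = 0 := by
    rw [← even_mul_comm (quad_mem_even x Q), quad_mul_top]
  have htop' (Q : Matrix (Fin 3) (Fin 3) K) : top x * (quad x 1 * quad x Q) = 0 := by
    rw [← mul_assoc, htop, zero_mul]
  -- Testing against `e³` sees only the constant term, and testing against `1` sees only the top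
  -- term.
  have hM : M.trace = 0 := by
    have h := horth _ hcube (diff_cube hx)
    rw [repr_apply, quad_one_cube] at h
    simpa [mul_add, mul_sub, htop, htop', top_mul_top] using h
  have hN : N.trace = 0 := by
    have h := horth 1 one_mem_even (diff_one K h)
    rw [one_mul, repr_apply, quad_one_cube] at h
    simpa [berezin_one x, berezin_quad x, berezin_quad_one_mul_quad x] using h
  rw [repr_apply, hM, hN] at horth
  simp only [zero_smul, mul_zero, sub_zero, zero_add, add_zero] at horth
  -- Every `e * quad Q` is closed, so `M` is orthogonal to all matrices under the trace form.
  have hM' (Q : Matrix (Fin 3) (Fin 3) K) : (Q * M).trace = 0 := by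
    have h := horth _ (mul_mem_even he (quad_mem_even x Q)) (diff_quad_mul_quad hx _ _)
    rw [mul_add, hquad, add_zero, quad_one_mul_quad_mul_quad, hM] at h
    simpa using h
  have hM0 : M = 0 := by
    ext i j
    have h := hM' (Matrix.single j i 1)
    simpa [Matrix.trace_single_mul] using h
  -- Only traceless `quad Q` is closed, so this shows merely that `N` is scalar; its vanishing trace
  -- finishes.
  have hN' (Q : Matrix (Fin 3) (Fin 3) K) (hQ : Q.trace = 0) : (Q * N).trace = 0 := by
    have h := horth _ (quad_mem_even x Q) (by rw [diff_quad hx, hQ, neg_zero, zero_smul])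
    rw [hM0, map_zero, zero_add, even_mul_comm (quad_mem_even x Q), quad_one_mul_quad_mul_quad,
      hQ, Matrix.trace_mul_comm] at h
    simpa using h
  have hoff (i j : Fin 3) (hij : i ≠ j) : N i j = 0 := by
    have h := hN' (Matrix.single j i 1) (Matrix.trace_single_eq_of_ne _ _ _ hij.symm)
    simpa [Matrix.trace_single_mul] using h
  have hdiag (i j : Fin 3) : N i i = N j j := by
    have h := hN' (Matrix.single i i 1 - Matrix.single j j 1) (by simp)
    rw [sub_mul, Matrix.trace_sub, Matrix.trace_single_mul, Matrix.trace_single_mul] at h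
    simpa [sub_eq_zero] using h
  have hN0 : N = 0 := by
    ext i j
    by_cases hij : i = j
    · subst hij
      have h : 3 * N i i = 0 := by
        rw [← hN, Matrix.trace]
        simp [hdiag _ i]
      simpa using h
    · exact hoff i j hij
  rw [hM0, hN0]
  rfl

end Heisenberg

end BigBracket

namespace BigBracket

/-! ### Cocycles and their classes. -/

section Cohomology

variable {K : Type*} [Field K] [CharZero K] {g : Type*} [LieRing g] [LieAlgebra K g]
  [Module.Finite K g]

/-- The even cocycle given by an even cochain with vanishing differential. -/
noncomputable def mkCocycle (c : Cochain K g) (hc : c ∈ evenPart K g) (hd : diff K g c = 0) :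
    evenCocycles K g :=
  ⟨(⟨c, hc⟩ : evenPart K g), hd⟩

theorem coe_mkCocycle (c : Cochain K g) (hc : c ∈ evenPart K g) (hd : diff K g c = 0) :
    (mkCocycle c hc hd).val.val = c := rfl

theorem evenCocycles_ext {a b : evenCocycles K g} (hab : a.val.val = b.val.val) : a = b :=
  Subtype.ext (EvenCochain.val_injective hab)

theorem cohClass_eq_zero_iff (z : evenCocycles K g) :
    cohClass z = 0 ↔ ∃ c, diff K g c = z.val.val :=
  Submodule.Quotient.mk_eq_zero (evenCoboundaries K g).toSubmodule

theorem cohClass_eq_iff (z z' : evenCocycles K g) :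
    cohClass z = cohClass z' ↔ ∃ c, diff K g c = z.val.val - z'.val.val := by
  rw [← sub_eq_zero, ← map_sub, cohClass_eq_zero_iff]
  rfl

theorem cohClass_surjective : Function.Surjective (cohClass (K := K) (g := g)) :=
  Submodule.mkQ_surjective _

theorem cohClass_lie (z z' : evenCocycles K g) : cohClass ⁅z, z'⁆ = ⁅cohClass z, cohClass z'⁆ :=
  rfl

end Cohomology

/-! ## The isomorphism with `gl(3) ⋉ gl(3)_ab` -/

section Isomorphism

variable {K : Type*} [Field K] [CharZero K] {h : Type*} [LieRing h] [LieAlgebra K h]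
  [Module.Finite K h] {x : Basis (Fin 3) K h}

/-- The class of the standard representative of an element of `gl(3) ⋉ gl(3)_ab`. -/
noncomputable def classHom (hx : IsHeisenbergBasis x) :
    GlSemidirect 3 K →ₗ⁅K⁆ EvenCohomology K h where
  toFun P := cohClass (mkCocycle (repr x ((GlAb.of 3 K).symm P.left, P.right))
    (repr_mem_even x _) (diff_repr hx _))
  map_add' P Q := by
    rw [← map_add]
    refine congrArg cohClass (evenCocycles_ext ?_)
    exact map_add (repr x) ((GlAb.of 3 K).symm P.left, P.right) ((GlAb.of 3 K).symm Q.left, Q.right)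
  map_smul' t P := by
    rw [RingHom.id_apply, ← map_smul]
    refine congrArg cohClass (evenCocycles_ext ?_)
    exact map_smul (repr x) t ((GlAb.of 3 K).symm P.left, P.right)
  map_lie' {P Q} := by
    rw [← cohClass_lie]
    refine congrArg cohClass (evenCocycles_ext ?_)
    refine Eq.trans ?_ (pbracket_repr x _ _ _ _).symm
    rw [coe_mkCocycle]
    congr 1
    refine Prod.ext ?_ rfl
    let A : Matrix (Fin 3) (Fin 3) K := (GlAb.of 3 K).symm P.left
    let B : Matrix (Fin 3) (Fin 3) K := (GlAb.of 3 K).symm Q.left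
    -- The leading zero is the bracket of the two components in the abelian ideal.
    change 0 + (P.right * B - B * P.right) - (Q.right * A - A * Q.right) =
      (P.right * B - B * P.right) - (Q.right * A - A * Q.right)
    rw [zero_add]

theorem classHom_apply (hx : IsHeisenbergBasis x) (P : GlSemidirect 3 K) :
    classHom hx P = cohClass (mkCocycle (repr x ((GlAb.of 3 K).symm P.left, P.right))
      (repr_mem_even x _) (diff_repr hx _)) := rfl

theorem classHom_bijective (hx : IsHeisenbergBasis x) : Function.Bijective (classHom hx) := by
  constructor
  · rw [injective_iff_map_eq_zero]
    intro P hP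
    rw [classHom_apply, cohClass_eq_zero_iff] at hP
    obtain ⟨c, hc⟩ := hP
    have h := repr_eq_zero_of_exact hx hc
    rw [Prod.mk_eq_zero] at h
    exact LieAlgebra.SemiDirectSum.ext h.1 h.2
  · intro y
    obtain ⟨z, rfl⟩ := cohClass_surjective y
    obtain ⟨⟨N, M⟩, c, hc⟩ := exists_repr_add_diff hx z.val.val_mem z.property
    refine ⟨⟨GlAb.of 3 K N, M⟩, ?_⟩
    rw [classHom_apply, cohClass_eq_iff]
    refine ⟨-c, ?_⟩
    rw [hc, coe_mkCocycle, map_neg]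
    simp

/-- The even cohomology of the Heisenberg algebra is `gl(3) ⋉ gl(3)_ab`. -/
noncomputable def cohEquiv (hx : IsHeisenbergBasis x) :
    GlSemidirect 3 K ≃ₗ⁅K⁆ EvenCohomology K h :=
  LieEquiv.ofBijective (classHom hx) (classHom_bijective hx)

theorem finrank_glSemidirect (n : ℕ) (K : Type*) [Field K] :
    finrank K (GlSemidirect n K) = 2 * (n * n) := by
  rw [(LieAlgebra.SemiDirectSum.toProdl (glAdjoint n K)).finrank_eq,
    ((GlAb.of n K).symm.prodCongr (LinearEquiv.refl K _)).finrank_eq, finrank_prod,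
    finrank_matrix]
  simp
  ring

end Isomorphism

/-! ## The bigrading of the even cohomology -/

section Bigrading

variable {K : Type*} [Field K] {g : Type*} [AddCommGroup g] [Module K g]

theorem inVec_mul_inDual (v : g) (φ : Dual K g) :
    inVec (K := K) v * inDual φ = -(inDual φ * inVec v) :=
  eq_neg_of_add_eq_zero_left (ExteriorAlgebra.ι_add_mul_swap _ _)

theorem range_inDual_commute_range_inVec :
    Commute (LinearMap.range (inDual (K := K) (g := g)))
      (LinearMap.range (inVec (K := K) (g := g))) := by
  apply le_antisymm
  · rw [Submodule.mul_le]
    rintro _ ⟨φ, rfl⟩ _ ⟨v, rfl⟩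
    rw [← neg_neg (inDual φ * inVec v), ← inVec_mul_inDual]
    exact neg_mem (Submodule.mul_mem_mul ⟨v, rfl⟩ ⟨φ, rfl⟩)
  · rw [Submodule.mul_le]
    rintro _ ⟨v, rfl⟩ _ ⟨φ, rfl⟩
    rw [inVec_mul_inDual]
    exact neg_mem (Submodule.mul_mem_mul ⟨φ, rfl⟩ ⟨v, rfl⟩)

theorem mul_mem_bidegree {p q p' q' : ℕ} {a b : Cochain K g} (ha : a ∈ bidegree K g p q)
    (hb : b ∈ bidegree K g p' q') : a * b ∈ bidegree K g (p + p') (q + q') := by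
  have h : bidegree K g (p + p') (q + q') = bidegree K g p q * bidegree K g p' q' := by
    have hc := range_inDual_commute_range_inVec (K := K) (g := g)
    rw [bidegree, bidegree, bidegree, pow_add, pow_add, mul_assoc, mul_assoc,
      ← mul_assoc _ (_ ^ q) (_ ^ q'), (hc.pow_pow p' q).eq, mul_assoc]
  rw [h]
  exact Submodule.mul_mem_mul ha hb

theorem inDual_mem_bidegree (φ : Dual K g) : inDual φ ∈ bidegree K g 1 0 := by
  rw [bidegree, pow_one, pow_zero, mul_one]
  exact ⟨φ, rfl⟩

theorem inVec_mem_bidegree (v : g) : inVec v ∈ bidegree K g 0 1 := by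
  rw [bidegree, pow_one, pow_zero, one_mul]
  exact ⟨v, rfl⟩

theorem one_mem_bidegree : (1 : Cochain K g) ∈ bidegree K g 0 0 := by
  rw [bidegree, pow_zero, pow_zero, mul_one]
  exact Submodule.one_le.1 le_rfl

/-- The automorphism of the cochains which scales `g*` by `2` and `g` by `3`. -/
noncomputable def scaling : Cochain K g →ₐ[K] Cochain K g :=
  ExteriorAlgebra.map (LinearMap.prodMap ((2 : K) • LinearMap.id) ((3 : K) • LinearMap.id))

theorem scaling_ι (v : Dual K g × g) : scaling (ExteriorAlgebra.ι K v) =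
    ExteriorAlgebra.ι K ((2 : K) • v.1, (3 : K) • v.2) :=
  ExteriorAlgebra.map_apply_ι _ _

theorem scaling_inDual (φ : Dual K g) : scaling (inDual φ) = (2 : K) • inDual φ := by
  refine (scaling_ι _).trans ?_
  rw [inDual, LinearMap.comp_apply, ← map_smul]
  simp

theorem scaling_inVec (v : g) : scaling (inVec v) = (3 : K) • inVec (K := K) v := by
  refine (scaling_ι _).trans ?_
  rw [inVec, LinearMap.comp_apply, ← map_smul]
  simp

theorem scaling_eq_smul_of_mem_pow {S : Submodule K (Cochain K g)} {t : K}
    (hS : ∀ c ∈ S, scaling c = t • c) (n : ℕ) : ∀ c ∈ S ^ n, scaling c = t ^ n • c := by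
  induction n with
  | zero =>
    intro c hc
    rw [pow_zero, Submodule.mem_one] at hc
    obtain ⟨r, rfl⟩ := hc
    rw [AlgHom.commutes, pow_zero, one_smul]
  | succ n ih =>
    intro c hc
    rw [pow_succ] at hc
    induction hc using Submodule.mul_induction_on' with
    | mem_mul_mem a ha b hb =>
      rw [map_mul, ih a ha, hS b hb, smul_mul_smul_comm, pow_succ]
    | add a _ b _ ha hb => rw [map_add, ha, hb, smul_add]

/-- The factors 2 and 3 are chosen so that the eigenvalue determines `(p, q)` by unique
factorization, in characteristic zero. -/
theorem scaling_of_mem_bidegree {p q : ℕ} {c : Cochain K g} (hc : c ∈ bidegree K g p q) :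
    scaling c = ((2 : K) ^ p * 3 ^ q) • c := by
  have h2 : ∀ c ∈ LinearMap.range (inDual (K := K) (g := g)), scaling c = (2 : K) • c := by
    rintro _ ⟨φ, rfl⟩
    exact scaling_inDual φ
  have h3 : ∀ c ∈ LinearMap.range (inVec (K := K) (g := g)), scaling c = (3 : K) • c := by
    rintro _ ⟨v, rfl⟩
    exact scaling_inVec v
  rw [bidegree] at hc
  induction hc using Submodule.mul_induction_on' with
  | mem_mul_mem a ha b hb =>
    rw [map_mul, scaling_eq_smul_of_mem_pow h2 p a ha, scaling_eq_smul_of_mem_pow h3 q b hb,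
      smul_mul_smul_comm]
  | add a _ b _ ha hb => rw [map_add, ha, hb, smul_add]

theorem parity_scaling (c : Cochain K g) : parity (scaling c) = scaling (parity c) := by
  induction c using ext_induction with
  | halg r => simp
  | hadd a b ha hb => simp [ha, hb]
  | hmul v c hc => simp [scaling_ι, parity_ι, hc]

theorem contr_scaling (f : Dual K (Dual K g × g)) (t : K)
    (hf : ∀ v : Dual K g × g, f ((2 : K) • v.1, (3 : K) • v.2) = t * f v) (c : Cochain K g) :
    contr f (scaling c) = t • scaling (contr f c) := by
  induction c using ext_induction with
  | halg r => simp [contr_algebraMap]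
  | hadd a b ha hb => simp [ha, hb]
  | hmul v c hc =>
    rw [map_mul, scaling_ι, contr_ι_mul, hf, hc, contr_ι_mul, map_sub, map_smul, map_mul,
      scaling_ι, smul_sub, smul_smul, mul_smul_comm]

/-- Each term of the bracket removes one factor from `g*` and one from `g`, which accounts for `6 =
2 * 3`. -/
theorem pbracket_scaling [Module.Finite K g] (a c : Cochain K g) :
    pbracket (scaling a) (scaling c) = (6 : K) • scaling (pbracket a c) := by
  have hv (v : g) (c : Cochain K g) :
      contr (formVec v) (scaling c) = (2 : K) • scaling (contr (formVec v) c) :=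
    contr_scaling _ _ (fun w => by simp [formVec]) c
  have hd (φ : Dual K g) (c : Cochain K g) :
      contr (formDual φ) (scaling c) = (3 : K) • scaling (contr (formDual φ) c) :=
    contr_scaling _ _ (fun w => by simp [formDual]) c
  simp only [pbracket_apply, map_sum, Finset.smul_sum, hv, hd, map_smul, parity_scaling, map_add,
    map_mul, smul_mul_smul_comm, smul_add]
  norm_num

end Bigrading

/-! ### Independence of the bihomogeneous parts of the cohomology. -/

section CohomologyBigrading

variable {K : Type*} [Field K] [CharZero K] {g : Type*} [LieRing g] [LieAlgebra K g]
  [Module.Finite K g]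

theorem mu_mem_bidegree {K : Type*} [Field K] {g : Type*} [LieRing g] [LieAlgebra K g]
    [Module.Finite K g] : mu K g ∈ bidegree K g 2 1 := by
  rw [mu]
  refine Submodule.smul_mem _ _ (Submodule.sum_mem _ fun i _ => Submodule.sum_mem _ fun j _ => ?_)
  exact mul_mem_bidegree (p := 2) (q := 0) (p' := 0) (q' := 1)
    (mul_mem_bidegree (p := 1) (q := 0) (p' := 1) (q' := 0) (inDual_mem_bidegree _)
      (inDual_mem_bidegree _)) (inVec_mem_bidegree _)

/-- Scaling multiplies `μ` by `2² * 3 = 12`, so the factor is `6/12`: the differential raises `p` by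
one. -/
theorem scaling_diff (c : Cochain K g) :
    diff K g (scaling c) = (2⁻¹ : K) • scaling (diff K g c) := by
  have h := pbracket_scaling (mu K g) c
  rw [scaling_of_mem_bidegree mu_mem_bidegree, map_smul, LinearMap.smul_apply] at h
  have h12 : ((2 : K) ^ 2 * 3 ^ 1) ≠ 0 := by norm_num
  rw [diff, ← inv_smul_smul₀ h12 (pbracket (mu K g) (scaling c)), h, smul_smul]
  norm_num

theorem scaling_mem_even {K : Type*} [Field K] [CharZero K] {g : Type*} [AddCommGroup g]
    [Module K g] {c : Cochain K g} (hc : c ∈ evenPart K g) :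
    scaling c ∈ evenPart K g := by
  rw [mem_even_iff, parity_scaling, parity_of_even hc]

variable (K g)

/-- The scaling of even cocycles. -/
noncomputable def cocycleScaling : evenCocycles K g →ₗ[K] evenCocycles K g where
  toFun z := mkCocycle (scaling z.val.val) (scaling_mem_even z.val.val_mem) (by
    rw [scaling_diff, z.property, map_zero, smul_zero])
  map_add' a b := evenCocycles_ext (map_add scaling a.val.val b.val.val)
  map_smul' t a := evenCocycles_ext (map_smul scaling t a.val.val)

/-- The scaling of the even cohomology. -/
noncomputable def cohScaling : EvenCohomology K g →ₗ[K] EvenCohomology K g :=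
  Submodule.mapQ (evenCoboundaries K g).toSubmodule (evenCoboundaries K g).toSubmodule
    (cocycleScaling K g) (by
      rintro z ⟨c, hc⟩
      refine ⟨(2 : K) • scaling c, ?_⟩
      rw [map_smul, scaling_diff, hc, smul_smul, mul_inv_cancel₀ two_ne_zero, one_smul]
      rfl)

theorem cohScaling_cohClass (z : evenCocycles K g) :
    cohScaling K g (cohClass z) = cohClass (cocycleScaling K g z) := rfl

theorem cohBidegree_le_eigenspace (p q : ℕ) :
    cohBidegree K g p q ≤ Module.End.eigenspace (cohScaling K g) (2 ^ p * 3 ^ q) := by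
  rintro _ ⟨z, hz, rfl⟩
  rw [Module.End.mem_eigenspace_iff, cohScaling_cohClass, ← map_smul]
  exact congrArg cohClass (evenCocycles_ext (scaling_of_mem_bidegree hz))

theorem iSupIndep_cohBidegree : iSupIndep (fun pq : {pq : ℕ × ℕ // Even (pq.1 + pq.2)} =>
    cohBidegree K g pq.1.1 pq.1.2) := by
  have hinj : Function.Injective (fun pq : {pq : ℕ × ℕ // Even (pq.1 + pq.2)} =>
      (2 : K) ^ pq.1.1 * 3 ^ pq.1.2) := by
    rintro ⟨⟨p, q⟩, _⟩ ⟨⟨p', q'⟩, _⟩ h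
    change (2 : K) ^ p * 3 ^ q = 2 ^ p' * 3 ^ q' at h
    have h' : 2 ^ p * 3 ^ q = 2 ^ p' * 3 ^ q' := by exact_mod_cast h
    have hp := congrArg (fun n => n.factorization 2) h'
    have hq := congrArg (fun n => n.factorization 3) h'
    have h32 : Nat.factorization 3 2 = 0 := Nat.factorization_eq_zero_of_not_dvd (by norm_num)
    have h23 : Nat.factorization 2 3 = 0 := Nat.factorization_eq_zero_of_not_dvd (by norm_num)
    have h22 : Nat.factorization 2 2 = 1 := Nat.prime_two.factorization_self
    have h33 : Nat.factorization 3 3 = 1 := Nat.prime_three.factorization_self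
    simp [Nat.factorization_mul, h32, h23, h22, h33] at hp hq
    simp [hp, hq]
  exact ((Module.End.eigenspaces_iSupIndep (cohScaling K g)).comp hinj).mono
    fun pq => cohBidegree_le_eigenspace K g pq.1.1 pq.1.2

variable {K g}

theorem cohClass_mem_iSup {p q : ℕ} (hpq : Even (p + q)) (z : evenCocycles K g)
    (hz : z.val.val ∈ bidegree K g p q) :
    cohClass z ∈ ⨆ pq : {pq : ℕ × ℕ // Even (pq.1 + pq.2)}, cohBidegree K g pq.1.1 pq.1.2 :=
  Submodule.mem_iSup_of_mem (⟨(p, q), hpq⟩ : {pq : ℕ × ℕ // Even (pq.1 + pq.2)}) ⟨z, hz, rfl⟩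

variable (K g) in
/-- The even cocycles whose class is a sum of bihomogeneous classes, as cochains. -/
noncomputable def bihomogeneousSums : Submodule K (Cochain K g) :=
  ((⨆ pq : {pq : ℕ × ℕ // Even (pq.1 + pq.2)}, cohBidegree K g pq.1.1 pq.1.2).comap cohClass).map
    (EvenCochain.val ∘ₗ (evenCocycles K g).toSubmodule.subtype)

theorem mem_bihomogeneousSums_of_mem_bidegree {p q : ℕ} (hpq : Even (p + q)) {c : Cochain K g}
    (hc : c ∈ bidegree K g p q) (he : c ∈ evenPart K g) (hd : diff K g c = 0) :
    c ∈ bihomogeneousSums K g :=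
  ⟨mkCocycle c he hd, cohClass_mem_iSup hpq _ hc, rfl⟩

theorem cohClass_mem_iSup_of_mem_bihomogeneousSums (z : evenCocycles K g)
    (hz : z.val.val ∈ bihomogeneousSums K g) :
    cohClass z ∈ ⨆ pq : {pq : ℕ × ℕ // Even (pq.1 + pq.2)}, cohBidegree K g pq.1.1 pq.1.2 := by
  obtain ⟨z', hz', hzz⟩ := hz
  rw [← evenCocycles_ext hzz]
  exact hz'

end CohomologyBigrading

/-! ### Bidegrees of quadratic elements. -/

section QuadBigrading

variable {K : Type*} [Field K] {h : Type*} [AddCommGroup h] [Module K h]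

/-- Positions 0, 1 lie in `h*` and position 2 in `h`, the reverse for momenta. So the block diagonal
part of a matrix has bidegree (1,1), and the off-diagonal blocks have bidegrees (2,0) and (0,2). -/
theorem quad_mem_bidegree_one_one (x : Basis (Fin 3) K h) (a b c d e : K) :
    quad x !![a, b, 0; c, d, 0; 0, 0, e] ∈ bidegree K h 1 1 := by
  have h00 (φ : Dual K h) (v : h) : inDual φ * inVec v ∈ bidegree K h 1 1 :=
    mul_mem_bidegree (p := 1) (q := 0) (p' := 0) (q' := 1) (inDual_mem_bidegree _)
      (inVec_mem_bidegree _)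
  have hq : quad x !![a, b, 0; c, d, 0; 0, 0, e] =
      a • (inDual (x.coord 0) * inVec (x 0)) + b • (inDual (x.coord 0) * inVec (x 1)) +
      c • (inDual (x.coord 1) * inVec (x 0)) + d • (inDual (x.coord 1) * inVec (x 1)) -
      e • (inDual (x.coord 2) * inVec (x 2)) := by
    rw [sub_eq_add_neg, ← smul_neg, ← inVec_mul_inDual]
    simp [quad_apply, Fin.sum_univ_three, pos, mom, posVec, momVec, inDual, inVec]
    module
  rw [hq]
  exact sub_mem (add_mem (add_mem (add_mem (Submodule.smul_mem _ _ (h00 _ _))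
    (Submodule.smul_mem _ _ (h00 _ _))) (Submodule.smul_mem _ _ (h00 _ _)))
    (Submodule.smul_mem _ _ (h00 _ _))) (Submodule.smul_mem _ _ (h00 _ _))

theorem quad_mem_bidegree_two_zero (x : Basis (Fin 3) K h) (a b : K) :
    quad x !![0, 0, a; 0, 0, b; 0, 0, 0] ∈ bidegree K h 2 0 := by
  have h00 (φ ψ : Dual K h) : inDual φ * inDual ψ ∈ bidegree K h 2 0 :=
    mul_mem_bidegree (p := 1) (q := 0) (p' := 1) (q' := 0) (inDual_mem_bidegree _)
      (inDual_mem_bidegree _)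
  have hq : quad x !![0, 0, a; 0, 0, b; 0, 0, 0] =
      a • (inDual (x.coord 0) * inDual (x.coord 2)) +
      b • (inDual (x.coord 1) * inDual (x.coord 2)) := by
    simp [quad_apply, Fin.sum_univ_three, pos, mom, posVec, momVec, inDual]
  rw [hq]
  exact add_mem (Submodule.smul_mem _ _ (h00 _ _)) (Submodule.smul_mem _ _ (h00 _ _))

theorem quad_mem_bidegree_zero_two (x : Basis (Fin 3) K h) (a b : K) :
    quad x !![0, 0, 0; 0, 0, 0; a, b, 0] ∈ bidegree K h 0 2 := by
  have h00 (v w : h) : inVec v * inVec w ∈ bidegree K h 0 2 :=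
    mul_mem_bidegree (p := 0) (q := 1) (p' := 0) (q' := 1) (inVec_mem_bidegree _)
      (inVec_mem_bidegree _)
  have hq : quad x !![0, 0, 0; 0, 0, 0; a, b, 0] =
      a • (inVec (x 2) * inVec (x 0)) + b • (inVec (x 2) * inVec (x 1)) := by
    simp [quad_apply, Fin.sum_univ_three, pos, mom, posVec, momVec, inVec]
  rw [hq]
  exact add_mem (Submodule.smul_mem _ _ (h00 _ _)) (Submodule.smul_mem _ _ (h00 _ _))

theorem quad_one_mem_bidegree (x : Basis (Fin 3) K h) : quad x 1 ∈ bidegree K h 1 1 := by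
  rw [Matrix.one_fin_three]
  exact quad_mem_bidegree_one_one x 1 0 0 1 1

theorem matrix_eq_add (M : Matrix (Fin 3) (Fin 3) K) :
    M = !![M 0 0, M 0 1, 0; M 1 0, M 1 1, 0; 0, 0, M 2 2] +
      !![0, 0, M 0 2; 0, 0, M 1 2; 0, 0, 0] + !![0, 0, 0; 0, 0, 0; M 2 0, M 2 1, 0] := by
  ext i j
  fin_cases i <;> fin_cases j <;> simp

end QuadBigrading

/-! ### The bihomogeneous parts span the cohomology. -/

section HeisenbergBigrading

variable {K : Type*} [Field K] [CharZero K] {h : Type*} [LieRing h] [LieAlgebra K h]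
  [Module.Finite K h] {x : Basis (Fin 3) K h}

/-- Each bihomogeneous block of the traceless part of `M` is itself closed, since the whole trace
sits in the (1,1) block. For `N`, all products `e * quad` are closed and `e` shifts the bidegree by
(1,1). -/
theorem repr_mem_bihomogeneousSums (hx : IsHeisenbergBasis x)
    (P : Matrix (Fin 3) (Fin 3) K × Matrix (Fin 3) (Fin 3) K) :
    repr x P ∈ bihomogeneousSums K h := by
  obtain ⟨N, M⟩ := P
  rw [repr_apply]
  have he := quad_mem_even x (1 : Matrix (Fin 3) (Fin 3) K)
  have he' := quad_one_mem_bidegree x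
  have htr : (M - (3⁻¹ * M.trace) • (1 : Matrix (Fin 3) (Fin 3) K)).trace = 0 := by
    simp [Matrix.trace_one, mul_comm]
  set M₀ := M - (3⁻¹ * M.trace) • (1 : Matrix (Fin 3) (Fin 3) K)
  refine add_mem (add_mem (add_mem (Submodule.smul_mem _ _ ?_) ?_) ?_) (Submodule.smul_mem _ _ ?_)
  · exact mem_bihomogeneousSums_of_mem_bidegree (p := 0) (q := 0) (by decide) one_mem_bidegree
      one_mem_even (diff_one K h)
  · have hq (Q : Matrix (Fin 3) (Fin 3) K) (hQ : Q.trace = 0) : diff K h (quad x Q) = 0 := by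
      rw [diff_quad hx, hQ, neg_zero, zero_smul]
    rw [matrix_eq_add M₀, map_add, map_add]
    refine add_mem (add_mem ?_ ?_) ?_
    · refine mem_bihomogeneousSums_of_mem_bidegree (p := 1) (q := 1) (by decide)
        (quad_mem_bidegree_one_one x _ _ _ _ _) (quad_mem_even x _) (hq _ ?_)
      rw [← htr, Matrix.trace_fin_three, Matrix.trace_fin_three]
      rfl
    · exact mem_bihomogeneousSums_of_mem_bidegree (p := 2) (q := 0) (by decide)
        (quad_mem_bidegree_two_zero x _ _) (quad_mem_even x _)
        (hq _ (by simp [Matrix.trace_fin_three]))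
    · exact mem_bihomogeneousSums_of_mem_bidegree (p := 0) (q := 2) (by decide)
        (quad_mem_bidegree_zero_two x _ _) (quad_mem_even x _)
        (hq _ (by simp [Matrix.trace_fin_three]))
  · rw [matrix_eq_add N, map_add, map_add, mul_add, mul_add]
    refine add_mem (add_mem ?_ ?_) ?_
    · exact mem_bihomogeneousSums_of_mem_bidegree (p := 2) (q := 2) (by decide)
        (mul_mem_bidegree (p := 1) (q := 1) (p' := 1) (q' := 1) he'
          (quad_mem_bidegree_one_one x _ _ _ _ _))
        (mul_mem_even he (quad_mem_even x _)) (diff_quad_mul_quad hx _ _)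
    · exact mem_bihomogeneousSums_of_mem_bidegree (p := 3) (q := 1) (by decide)
        (mul_mem_bidegree (p := 1) (q := 1) (p' := 2) (q' := 0) he'
          (quad_mem_bidegree_two_zero x _ _))
        (mul_mem_even he (quad_mem_even x _)) (diff_quad_mul_quad hx _ _)
    · exact mem_bihomogeneousSums_of_mem_bidegree (p := 1) (q := 3) (by decide)
        (mul_mem_bidegree (p := 1) (q := 1) (p' := 0) (q' := 2) he'
          (quad_mem_bidegree_zero_two x _ _))
        (mul_mem_even he (quad_mem_even x _)) (diff_quad_mul_quad hx _ _)
  · exact mem_bihomogeneousSums_of_mem_bidegree (p := 3) (q := 3) (by decide)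
      (mul_mem_bidegree (p := 2) (q := 2) (p' := 1) (q' := 1)
        (mul_mem_bidegree (p := 1) (q := 1) (p' := 1) (q' := 1) he' he') he')
      (mul_mem_even (mul_mem_even he he) he)
      (diff_cube hx)

theorem isInternal_cohBidegree (hx : IsHeisenbergBasis x) :
    DirectSum.IsInternal (fun pq : {pq : ℕ × ℕ // Even (pq.1 + pq.2)} =>
      cohBidegree K h pq.1.1 pq.1.2) := by
  rw [DirectSum.isInternal_submodule_iff_iSupIndep_and_iSup_eq_top]
  refine ⟨iSupIndep_cohBidegree K h, ?_⟩
  rw [eq_top_iff]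
  intro y _
  obtain ⟨P, rfl⟩ := (classHom_bijective hx).2 y
  exact cohClass_mem_iSup_of_mem_bihomogeneousSums _ (repr_mem_bihomogeneousSums hx _)

end HeisenbergBigrading

end BigBracket

/-! ## Derivations of the Heisenberg algebra -/

namespace Heisenberg

open LieAlgebra.SpecialLinear BigBracket

variable {K : Type*} [Field K] {h : Type*} [LieRing h] [LieAlgebra K h]
  {x : Basis (Fin 3) K h}

/-- The matrix of a derivation. -/
noncomputable def derMatrix (x : Basis (Fin 3) K h) (D : LieDerivation K h h) :
    Matrix (Fin 3) (Fin 3) K :=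
  LinearMap.toMatrix x x (D : h →ₗ[K] h)

theorem derMatrix_apply (D : LieDerivation K h h) (i j : Fin 3) :
    derMatrix x D i j = x.coord i (D (x j)) :=
  LinearMap.toMatrix_apply x x _ i j

theorem apply_eq_sum_derMatrix (D : LieDerivation K h h) (j : Fin 3) :
    D (x j) = derMatrix x D 0 j • x 0 + derMatrix x D 1 j • x 1 + derMatrix x D 2 j • x 2 := by
  conv_lhs => rw [← x.sum_repr (D (x j)), Fin.sum_univ_three]
  simp only [derMatrix_apply]
  rfl

theorem derMatrix_add (D D' : LieDerivation K h h) :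
    derMatrix x (D + D') = derMatrix x D + derMatrix x D' :=
  map_add (LinearMap.toMatrix x x) (D : h →ₗ[K] h) D'

theorem derMatrix_smul (t : K) (D : LieDerivation K h h) :
    derMatrix x (t • D) = t • derMatrix x D :=
  map_smul (LinearMap.toMatrix x x) t (D : h →ₗ[K] h)

theorem derMatrix_lie (D D' : LieDerivation K h h) :
    derMatrix x ⁅D, D'⁆ = derMatrix x D * derMatrix x D' - derMatrix x D' * derMatrix x D := by
  rw [derMatrix, derMatrix, derMatrix, ← LinearMap.toMatrix_comp, ← LinearMap.toMatrix_comp,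
    ← map_sub]
  rfl

theorem derMatrix_injective : Function.Injective (derMatrix (K := K) x) := by
  intro D D' hD
  have h1 : (D : h →ₗ[K] h) = D' := (LinearMap.toMatrix x x).injective hD
  exact LieDerivation.ext fun v => LinearMap.congr_fun h1 v

theorem lie_eq (hx : IsHeisenbergBasis x) (a b : h) :
    ⁅a, b⁆ = (x.coord 0 a * x.coord 1 b - x.coord 1 a * x.coord 0 b) • x 2 := by
  have h10 : ⁅x 1, x 0⁆ = -x 2 := by rw [← lie_skew, hx.lie_zero_one]
  have h20 : ⁅x 2, x 0⁆ = 0 := by rw [← lie_skew, hx.lie_zero_two, neg_zero]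
  have h21 : ⁅x 2, x 1⁆ = 0 := by rw [← lie_skew, hx.lie_one_two, neg_zero]
  conv_lhs => rw [← x.sum_repr a, ← x.sum_repr b]
  simp only [Fin.sum_univ_three, add_lie, lie_add, smul_lie, lie_smul, lie_self, hx.lie_zero_one,
    hx.lie_zero_two, hx.lie_one_two, h10, h20, h21, Basis.coord_apply]
  module

theorem apply_x_two (hx : IsHeisenbergBasis x) (D : LieDerivation K h h) :
    D (x 2) = (derMatrix x D 0 0 + derMatrix x D 1 1) • x 2 := by
  conv_lhs => rw [← hx.lie_zero_one]
  rw [D.apply_lie_eq_sub, lie_eq hx, lie_eq hx, ← sub_smul]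
  congr 1
  simp [derMatrix_apply]
  ring

theorem derMatrix_zero_two (hx : IsHeisenbergBasis x) (D : LieDerivation K h h) :
    derMatrix x D 0 2 = 0 := by
  rw [derMatrix_apply, apply_x_two hx]
  simp

theorem derMatrix_one_two (hx : IsHeisenbergBasis x) (D : LieDerivation K h h) :
    derMatrix x D 1 2 = 0 := by
  rw [derMatrix_apply, apply_x_two hx]
  simp

theorem derMatrix_two_two (hx : IsHeisenbergBasis x) (D : LieDerivation K h h) :
    derMatrix x D 2 2 = derMatrix x D 0 0 + derMatrix x D 1 1 := by
  rw [derMatrix_apply, apply_x_two hx]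
  simp

/-- The contragredient action of the derivations on the dual of the abelianization. -/
noncomputable def derGl₂ (hx : IsHeisenbergBasis x) :
    LieDerivation K h h →ₗ⁅K⁆ Matrix (Fin 2) (Fin 2) K where
  toFun D := !![-derMatrix x D 0 0, -derMatrix x D 1 0; -derMatrix x D 0 1, -derMatrix x D 1 1]
  map_add' D D' := by
    ext i j
    fin_cases i <;> fin_cases j <;> simp [derMatrix_add] <;> ring
  map_smul' t D := by
    ext i j
    fin_cases i <;> fin_cases j <;> simp [derMatrix_smul]
  map_lie' {D D'} := by
    ext i j
    fin_cases i <;> fin_cases j <;>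
      simp [derMatrix_lie, Ring.lie_def, Matrix.mul_apply, Fin.sum_univ_three,
        derMatrix_zero_two hx, derMatrix_one_two hx] <;> ring

/-- The matrix in `sl(3)` of the class of minus a derivation. -/
noncomputable def derGl₃ (hx : IsHeisenbergBasis x) :
    LieDerivation K h h →ₗ⁅K⁆ Matrix (Fin 3) (Fin 3) K where
  toFun D := !![-derMatrix x D 0 0, -derMatrix x D 1 0, 0;
    -derMatrix x D 0 1, -derMatrix x D 1 1, 0;
    0, 0, derMatrix x D 2 2]
  map_add' D D' := by
    ext i j
    fin_cases i <;> fin_cases j <;> simp [derMatrix_add] <;> ring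
  map_smul' t D := by
    ext i j
    fin_cases i <;> fin_cases j <;> simp [derMatrix_smul]
  map_lie' {D D'} := by
    ext i j
    fin_cases i <;> fin_cases j <;>
      simp [derMatrix_lie, Ring.lie_def, Matrix.mul_apply, Fin.sum_univ_three,
        derMatrix_zero_two hx, derMatrix_one_two hx] <;> ring

theorem derGl₂_apply (hx : IsHeisenbergBasis x) (D : LieDerivation K h h) : derGl₂ hx D =
    !![-derMatrix x D 0 0, -derMatrix x D 1 0; -derMatrix x D 0 1, -derMatrix x D 1 1] := rfl

theorem derGl₃_apply (hx : IsHeisenbergBasis x) (D : LieDerivation K h h) : derGl₃ hx D =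
    !![-derMatrix x D 0 0, -derMatrix x D 1 0, 0; -derMatrix x D 0 1, -derMatrix x D 1 1, 0;
      0, 0, derMatrix x D 2 2] := rfl

theorem derGl₃_trace (hx : IsHeisenbergBasis x) (D : LieDerivation K h h) :
    (derGl₃ hx D).trace = 0 := by
  rw [derGl₃_apply, derMatrix_two_two hx, Matrix.trace_fin_three]
  simp
  ring

theorem derGl₂_eq_zero_iff (hx : IsHeisenbergBasis x) (D : LieDerivation K h h) :
    derGl₂ hx D = 0 ↔ derMatrix x D 0 0 = 0 ∧ derMatrix x D 1 0 = 0 ∧ derMatrix x D 0 1 = 0 ∧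
      derMatrix x D 1 1 = 0 := by
  rw [derGl₂_apply, ← Matrix.ext_iff]
  simp [Fin.forall_fin_two, and_assoc]

theorem derGl₂_eq_zero_of_derGl₃ (hx : IsHeisenbergBasis x) (D : LieDerivation K h h)
    (hD : derGl₃ hx D = 0) : derGl₂ hx D = 0 := by
  rw [derGl₂_eq_zero_iff]
  rw [derGl₃_apply] at hD
  have h00 := congrFun (congrFun hD 0) 0
  have h01 := congrFun (congrFun hD 0) 1
  have h10 := congrFun (congrFun hD 1) 0
  have h11 := congrFun (congrFun hD 1) 1
  simp at h00 h01 h10 h11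
  exact ⟨h00, h01, h10, h11⟩

theorem finite_lieDerivation [Module.Finite K h] : Module.Finite K (LieDerivation K h h) := by
  let f : LieDerivation K h h →ₗ[K] (h →ₗ[K] h) :=
    { toFun := fun D => D, map_add' := fun _ _ => rfl, map_smul' := fun _ _ => rfl }
  refine Module.Finite.of_injective f fun D D' hD => ?_
  exact LieDerivation.ext fun v => LinearMap.congr_fun hD v

/-- The derivations which preserve the span of `x₁` and `x₋₁` and kill `h₀`. -/
noncomputable def derLevi (x : Basis (Fin 3) K h) : LieSubalgebra K (LieDerivation K h h) where
  carrier := {D | ∀ j, derMatrix x D 2 j = 0}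
  add_mem' {D D'} hD hD' j := by rw [derMatrix_add, Matrix.add_apply, hD, hD', add_zero]
  zero_mem' j := by
    have h0 : derMatrix x (0 : LieDerivation K h h) = 0 := map_zero (LinearMap.toMatrix x x)
    rw [h0, Matrix.zero_apply]
  smul_mem' t D hD j := by rw [derMatrix_smul, Matrix.smul_apply, hD, smul_zero]
  lie_mem' {D D'} hD hD' j := by
    have hD1 : ∀ j, derMatrix x D 2 j = 0 := hD
    have hD2 : ∀ j, derMatrix x D' 2 j = 0 := hD'
    simp [derMatrix_lie, Matrix.mul_apply, hD1, hD2]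

theorem mem_derLevi (D : LieDerivation K h h) : D ∈ derLevi x ↔ ∀ j, derMatrix x D 2 j = 0 :=
  Iff.rfl

theorem endCochain_eq [Module.Finite K h] {n : Type*} [Fintype n] (b : Basis n K h)
    (D : h →ₗ[K] h) :
    endCochain D = ∑ i, inDual (b.coord i) * inVec (D (b i)) := by
  let F : h →ₗ[K] Dual K h →ₗ[K] Cochain K h :=
    (LinearMap.mul K (Cochain K h)).flip.compl₁₂ (inVec ∘ₗ D) inDual
  exact sum_coord_basis_indep (finBasis K h) b F

/-- On `x₁*, x₋₁*` the matrix is minus the transpose of that of `D`; the last entry changes sign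
because `h₀` and `h₀*` are interchanged as position and momentum. The components of `D x₁`, `D x₋₁`
along `h₀` give products of two positions, which are exact. -/
theorem endCochain_eq_quad [Module.Finite K h] (hx : IsHeisenbergBasis x)
    (D : LieDerivation K h h) :
    -endCochain (D : h →ₗ[K] h) = quad x (derGl₃ hx D) -
      derMatrix x D 2 0 • (pos x 0 * pos x 2) - derMatrix x D 2 1 • (pos x 1 * pos x 2) := by
  have p0 : inDual (x.coord 0) = pos x 0 := rfl
  have p1 : inDual (x.coord 1) = pos x 1 := rfl
  have p2 : inVec (K := K) (x 2) = pos x 2 := rfl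
  have m0 : inVec (K := K) (x 0) = mom x 0 := rfl
  have m1 : inVec (K := K) (x 1) = mom x 1 := rfl
  have m2 : inDual (x.coord 2) = mom x 2 := rfl
  rw [endCochain_eq x, Fin.sum_univ_three]
  simp only [LieDerivation.coeFn_coe]
  rw [apply_eq_sum_derMatrix (x := x) D 0, apply_eq_sum_derMatrix (x := x) D 1,
    apply_eq_sum_derMatrix (x := x) D 2, derMatrix_zero_two hx, derMatrix_one_two hx]
  simp only [map_add, map_smul, p0, p1, p2, m0, m1, m2, quad_apply, Fin.sum_univ_three,
    derGl₃_apply]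
  simp [mul_add]
  module

variable [CharZero K]

/-- The quotient of the derivations by their radical. -/
noncomputable def derSl₂ (hx : IsHeisenbergBasis x) : LieDerivation K h h →ₗ⁅K⁆ sl (Fin 2) K :=
  (tracelessPart (Fin 2) K).comp (derGl₂ hx)

theorem derSl₂_eq_zero_iff (hx : IsHeisenbergBasis x) (D : LieDerivation K h h) :
    derSl₂ hx D = 0 ↔ derMatrix x D 0 1 = 0 ∧ derMatrix x D 1 0 = 0 ∧
      derMatrix x D 0 0 = derMatrix x D 1 1 := by
  have h0 : derSl₂ hx D = 0 ↔ derGl₂ hx D = ((2 : K)⁻¹ * (derGl₂ hx D).trace) • 1 := by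
    rw [← Subtype.coe_inj, derSl₂, LieHom.comp_apply, coe_tracelessPart]
    simp [sub_eq_zero]
  rw [h0, derGl₂_apply, Matrix.trace_fin_two, ← Matrix.ext_iff]
  simp only [Fin.forall_fin_two, Matrix.of_apply, Matrix.cons_val, Matrix.smul_apply,
    Matrix.one_apply_eq, smul_eq_mul, mul_one, Matrix.one_apply_ne zero_ne_one,
    Matrix.one_apply_ne one_ne_zero, mul_zero, neg_eq_zero]
  constructor
  · rintro ⟨⟨h00, h10⟩, h01, -⟩
    refine ⟨h01, h10, ?_⟩
    linear_combination (-2) * h00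
  · rintro ⟨h01, h10, h00⟩
    refine ⟨⟨?_, h10⟩, h01, ?_⟩ <;> rw [h00] <;> ring

/-- The kernel consists of derivations that are scalar on the abelianization. Their commutators
vanish there, hence also on `h₀`, so they map `h` into the line of `h₀` and commute with one
another. -/
theorem isSolvable_ker_derSl₂ (hx : IsHeisenbergBasis x) :
    LieAlgebra.IsSolvable (derSl₂ hx).ker := by
  refine (LieAlgebra.isSolvable_iff K _).2 ⟨2, ?_⟩
  rw [LieIdeal.derivedSeries_eq_bot_iff]
  have h1 : LieAlgebra.derivedSeriesOfIdeal K _ 1 (derSl₂ hx).ker ≤ (derGl₂ hx).ker := by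
    rw [LieAlgebra.derivedSeriesOfIdeal_succ, LieAlgebra.derivedSeriesOfIdeal_zero,
      LieSubmodule.lie_le_iff]
    intro D hD D' hD'
    rw [LieHom.mem_ker, derSl₂_eq_zero_iff] at hD hD'
    rw [LieHom.mem_ker, LieHom.map_lie, derGl₂_apply, derGl₂_apply, hD.1, hD.2.1, hD.2.2, hD'.1,
      hD'.2.1, hD'.2.2]
    ext i j
    fin_cases i <;> fin_cases j <;> simp [Ring.lie_def, mul_comm]
  rw [LieAlgebra.derivedSeriesOfIdeal_succ, eq_bot_iff]
  refine (LieSubmodule.mono_lie h1 h1).trans ?_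
  rw [LieSubmodule.lie_le_iff]
  intro D hD D' hD'
  rw [LieSubmodule.mem_bot]
  apply derMatrix_injective (x := x)
  rw [LieHom.mem_ker, derGl₂_eq_zero_iff] at hD hD'
  have h22 := derMatrix_two_two hx D
  have h22' := derMatrix_two_two hx D'
  rw [hD.1, hD.2.2.2, add_zero] at h22
  rw [hD'.1, hD'.2.2.2, add_zero] at h22'
  have h0 : derMatrix x (0 : LieDerivation K h h) = 0 := map_zero (LinearMap.toMatrix x x)
  rw [derMatrix_lie, h0]
  ext i j
  fin_cases i <;> fin_cases j <;> simp [Matrix.mul_apply, Fin.sum_univ_three, hD, hD', h22, h22',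
    derMatrix_zero_two hx, derMatrix_one_two hx]

theorem exists_mem_derLevi (hx : IsHeisenbergBasis x) (B : sl (Fin 2) K) :
    ∃ D ∈ derLevi x, derSl₂ hx D = B := by
  obtain ⟨B, hB⟩ := B
  have htr := mem_sl.1 hB
  rw [Matrix.trace_fin_two] at htr
  -- Minus the transpose of `B`, which the contragredient `derGl₂` turns back into `B`; the zero
  -- last entry is consistent with `tr B = 0`.
  let A : Matrix (Fin 3) (Fin 3) K := !![-B 0 0, -B 1 0, 0; -B 0 1, -B 1 1, 0; 0, 0, 0]
  let L : h →ₗ[K] h := LinearMap.toMatrix x x |>.symm A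
  have hL (i : Fin 3) (v : h) : x.coord i (L v) = ∑ j, A i j * x.coord j v := by
    have h1 := congrFun (LinearMap.toMatrix_mulVec_repr x x L v) i
    rw [LinearEquiv.apply_symm_apply] at h1
    exact h1.symm
  have hL2 : L (x 2) = 0 := by
    refine x.ext_elem fun i => ?_
    have h1 := hL i (x 2)
    rw [Fin.sum_univ_three] at h1
    refine h1.trans ?_
    fin_cases i <;> simp [A]
  let D : LieDerivation K h h :=
    { toLinearMap := L
      leibniz' := fun a b => by
        rw [lie_eq hx, lie_eq hx, lie_eq hx, map_smul, hL2, smul_zero, ← sub_smul]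
        simp only [hL, Fin.sum_univ_three]
        -- As `L` kills `h₀`, the Leibniz rule asks the right side to vanish; its coefficient is a
        -- multiple of `tr B`.
        symm
        convert zero_smul K (x 2) using 2
        simp [A]
        linear_combination (x.repr a 1 * x.repr b 0 - x.repr a 0 * x.repr b 1) * htr }
  have hD : derMatrix x D = A := LinearEquiv.apply_symm_apply (LinearMap.toMatrix x x) A
  refine ⟨D, fun j => ?_, ?_⟩
  · rw [hD]
    fin_cases j <;> rfl
  · have h2 : derGl₂ hx D = B := by
      rw [derGl₂_apply, hD]
      ext i j
      fin_cases i <;> fin_cases j <;> simp [A]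
    rw [derSl₂, LieHom.comp_apply, h2]
    exact tracelessPart_coe (Fin 2) K ⟨B, hB⟩

theorem derSl₂_surjective (hx : IsHeisenbergBasis x) : Function.Surjective (derSl₂ hx) := fun B =>
  (exists_mem_derLevi hx B).imp fun _ hD => hD.2

theorem isLeviFactor_derLevi [Module.Finite K h] (hx : IsHeisenbergBasis x) :
    IsLeviFactor (derLevi x) := by
  have := finite_lieDerivation (K := K) (h := h)
  refine LieAlgebra.isLeviFactor_of_bijective (derSl₂ hx) (isSolvable_ker_derSl₂ hx) _ ⟨?_, ?_⟩
  · rw [injective_iff_map_eq_zero]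
    rintro ⟨D, hD⟩ h0
    have h1 : derSl₂ hx D = 0 := h0
    rw [derSl₂_eq_zero_iff] at h1
    rw [mem_derLevi] at hD
    have h22 := derMatrix_two_two hx D
    -- The eigenvalue on `h₀` is twice the scalar on the abelianization, so killing `h₀` kills the
    -- scalar.
    rw [hD, h1.2.2, ← two_mul] at h22
    have h11 : derMatrix x D 1 1 = 0 := by simpa using h22.symm
    refine Subtype.ext (derMatrix_injective (x := x) ?_)
    have h0 : derMatrix x (0 : LieDerivation K h h) = 0 := map_zero (LinearMap.toMatrix x x)
    refine Eq.trans ?_ h0.symm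
    ext i j
    fin_cases i <;> fin_cases j <;> simp [h1, hD, h11, derMatrix_zero_two hx,
      derMatrix_one_two hx]
  · intro B
    obtain ⟨D, hD, hB⟩ := exists_mem_derLevi hx B
    exact ⟨⟨D, hD⟩, hB⟩

/-! ## Levi factors of the even cohomology -/

variable [Module.Finite K h]

/-- The quotient of the even cohomology by its radical. -/
noncomputable def cohSl₃ (hx : IsHeisenbergBasis x) : EvenCohomology K h →ₗ⁅K⁆ sl (Fin 3) K :=
  ((tracelessPart (Fin 3) K).comp (LieAlgebra.SemiDirectSum.projr (glAdjoint 3 K))).comp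
    (cohEquiv hx).symm.toLieHom

theorem cohSl₃_cohEquiv (hx : IsHeisenbergBasis x) (P : GlSemidirect 3 K) :
    cohSl₃ hx (cohEquiv hx P) = tracelessPart (Fin 3) K P.right := by
  change tracelessPart (Fin 3) K ((cohEquiv hx).symm (cohEquiv hx P)).right = _
  rw [LieEquiv.symm_apply_apply]

/-- The embedding of `gl(3)` in the even cohomology. -/
noncomputable def glHom (hx : IsHeisenbergBasis x) :
    Matrix (Fin 3) (Fin 3) K →ₗ⁅K⁆ EvenCohomology K h :=
  (cohEquiv hx).toLieHom.comp (LieAlgebra.SemiDirectSum.inr (glAdjoint 3 K))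

theorem glHom_apply (hx : IsHeisenbergBasis x) (M : Matrix (Fin 3) (Fin 3) K) :
    glHom hx M = cohEquiv hx ⟨0, M⟩ := rfl

theorem glHom_injective (hx : IsHeisenbergBasis x) : Function.Injective (glHom hx) := by
  intro M M' hM
  exact congrArg LieAlgebra.SemiDirectSum.right ((cohEquiv hx).injective hM)

theorem cohSl₃_surjective (hx : IsHeisenbergBasis x) : Function.Surjective (cohSl₃ hx) := by
  intro A
  refine ⟨glHom hx A, ?_⟩
  rw [glHom_apply, cohSl₃_cohEquiv]
  exact tracelessPart_coe (Fin 3) K A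

/-- The kernel is the scalar matrices together with `gl(3)_ab`. Scalars are central and act
trivially by the adjoint action, so it is abelian. -/
theorem isSolvable_ker_cohSl₃ (hx : IsHeisenbergBasis x) :
    LieAlgebra.IsSolvable (cohSl₃ hx).ker := by
  have hab : IsLieAbelian (cohSl₃ hx).ker := by
    constructor
    rintro ⟨a, ha⟩ ⟨b, hb⟩
    rw [LieHom.mem_ker] at ha hb
    obtain ⟨P, rfl⟩ := (cohEquiv hx).surjective a
    obtain ⟨Q, rfl⟩ := (cohEquiv hx).surjective b
    replace ha := (cohSl₃_cohEquiv hx P).symm.trans ha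
    replace hb := (cohSl₃_cohEquiv hx Q).symm.trans hb
    have hP := congrArg Subtype.val ha
    have hQ := congrArg Subtype.val hb
    rw [coe_tracelessPart] at hP hQ
    have hP' := sub_eq_zero.1 hP
    have hQ' := sub_eq_zero.1 hQ
    have hcent (s : K) (Y : Matrix (Fin 3) (Fin 3) K) :
        ⁅s • (1 : Matrix (Fin 3) (Fin 3) K), Y⁆ = 0 := by
      simp [Ring.lie_def]
    have had (s : K) (Y : GlAb 3 K) :
        glAdjoint 3 K (s • (1 : Matrix (Fin 3) (Fin 3) K)) Y = 0 := hcent s _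
    have h0 : ⁅P, Q⁆ = 0 := by
      rw [LieAlgebra.SemiDirectSum.lie_eq_mk, hP', hQ', hcent, had, had, GlAb.lie_eq_zero]
      simp
    refine Subtype.ext ?_
    change ⁅cohEquiv hx P, cohEquiv hx Q⁆ = 0
    rw [← LieEquiv.map_lie, h0, map_zero]
  infer_instance

/-- The canonical Levi factor of the even cohomology. -/
noncomputable def cohLevi (hx : IsHeisenbergBasis x) : LieSubalgebra K (EvenCohomology K h) :=
  (sl (Fin 3) K).map (glHom hx)

theorem finite_evenCohomology (hx : IsHeisenbergBasis x) :
    Module.Finite K (EvenCohomology K h) := by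
  have h1 : 0 < finrank K (GlSemidirect 3 K) := by
    rw [finrank_glSemidirect]
    norm_num
  have := Module.finite_of_finrank_pos h1
  exact Module.Finite.equiv (cohEquiv hx).toLinearEquiv

theorem isLeviFactor_cohLevi (hx : IsHeisenbergBasis x) : IsLeviFactor (cohLevi hx) := by
  have := finite_evenCohomology hx
  have key (A : sl (Fin 3) K) : cohSl₃ hx (glHom hx A) = A := by
    rw [glHom_apply, cohSl₃_cohEquiv]
    exact tracelessPart_coe (Fin 3) K A
  refine LieAlgebra.isLeviFactor_of_bijective (cohSl₃ hx) (isSolvable_ker_cohSl₃ hx) _ ⟨?_, ?_⟩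
  · rw [injective_iff_map_eq_zero]
    rintro ⟨_, A, hA, rfl⟩ h0
    have h1 : (⟨A, hA⟩ : sl (Fin 3) K) = 0 := (key ⟨A, hA⟩).symm.trans h0
    have h2 : A = 0 := congrArg Subtype.val h1
    subst h2
    exact Subtype.ext (map_zero (glHom hx))
  · intro A
    exact ⟨⟨glHom hx A, A, A.property, rfl⟩, key A⟩

/-! ## The map from derivations to the even cohomology -/

/-- The homomorphism `D ↦ -[D]`. -/
noncomputable def derClass (hx : IsHeisenbergBasis x) :
    LieDerivation K h h →ₗ⁅K⁆ EvenCohomology K h :=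
  (glHom hx).comp (derGl₃ hx)

theorem derClass_spec (hx : IsHeisenbergBasis x) (D : LieDerivation K h h) :
    ∃ z : evenCocycles K h, z.val.val = -endCochain (D : h →ₗ[K] h) ∧
      derClass hx D = cohClass z := by
  have heven : -endCochain (D : h →ₗ[K] h) ∈ evenPart K h := by
    rw [endCochain_eq_quad hx]
    exact sub_mem (sub_mem (quad_mem_even x _) (Submodule.smul_mem _ _ (ι_mul_ι_mem_even _ _)))
      (Submodule.smul_mem _ _ (ι_mul_ι_mem_even _ _))
  have hdiff : diff K h (-endCochain (D : h →ₗ[K] h)) = 0 := by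
    rw [endCochain_eq_quad hx, map_sub, map_sub, diff_quad hx, derGl₃_trace]
    simp [diff_mul hx, diff_pos hx]
  refine ⟨mkCocycle _ heven hdiff, rfl, ?_⟩
  change classHom hx ⟨0, derGl₃ hx D⟩ = _
  rw [classHom_apply, cohClass_eq_iff]
  -- A primitive of the terms in `pos 0 * pos 2` and `pos 1 * pos 2` from `endCochain_eq_quad`; the
  -- minus sign is that of `diff_mom_one`.
  refine ⟨derMatrix x D 2 1 • mom x 0 - derMatrix x D 2 0 • mom x 1, ?_⟩
  rw [coe_mkCocycle, coe_mkCocycle, endCochain_eq_quad hx, repr_apply, derGl₃_trace]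
  simp [diff_mom_zero hx, diff_mom_one hx]
  module

/-- A derivation with zero class acts trivially on the abelianization, so it lies in the radical,
which meets a Levi factor only in zero. -/
theorem derClass_injOn (hx : IsHeisenbergBasis x) (S : LieSubalgebra K (LieDerivation K h h))
    (hS : IsLeviFactor S) : Set.InjOn (derClass hx) S := by
  have := finite_lieDerivation (K := K) (h := h)
  intro D hD D' hD' hDD
  have h1 : derClass hx (D - D') = 0 := by rw [map_sub, hDD, sub_self]
  have h2 : derGl₃ hx (D - D') = 0 := glHom_injective hx (by rw [map_zero]; exact h1)
  have h3 : derSl₂ hx (D - D') = 0 := by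
    rw [derSl₂, LieHom.comp_apply, derGl₂_eq_zero_of_derGl₃ hx _ h2, map_zero]
  have h4 : D - D' ∈ LieAlgebra.radical K (LieDerivation K h h) := by
    rw [LieAlgebra.radical_eq_ker (derSl₂ hx) (derSl₂_surjective hx) (isSolvable_ker_derSl₂ hx)]
    exact LieHom.mem_ker.2 h3
  exact sub_eq_zero.1 (Submodule.disjoint_def.1 hS.isCompl.disjoint _ (sub_mem hD hD') h4)

/-- All classes of derivations come from block diagonal traceless matrices; the class of `E_{02}`
lies in the Levi factor but is not of this form. -/
theorem map_derClass_lt (hx : IsHeisenbergBasis x) (S : LieSubalgebra K (LieDerivation K h h)) :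
    S.map (derClass hx) < cohLevi hx := by
  rw [SetLike.lt_iff_le_and_exists]
  constructor
  · rintro _ ⟨D, -, rfl⟩
    exact ⟨derGl₃ hx D, mem_sl.2 (derGl₃_trace hx D), rfl⟩
  · refine ⟨glHom hx (Matrix.single 0 2 1), ⟨_, mem_sl.2 (Matrix.trace_single_eq_of_ne _ _ _
      (by decide)), rfl⟩, ?_⟩
    rintro ⟨D, -, hD⟩
    have h1 : derGl₃ hx D = Matrix.single 0 2 1 := glHom_injective hx hD
    have h2 := congrFun (congrFun h1 0) 2
    rw [derGl₃_apply] at h2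
    simp at h2

end Heisenberg

/-! ### Structure of the even cohomology and its Levi factors. -/

theorem mainTheorem1 {K : Type*} [Field K] [CharZero K] {h : Type*} [LieRing h] [LieAlgebra K h]
    [Module.Finite K h] (x : Module.Basis (Fin 3) K h) (hx : IsHeisenbergBasis x) :
    -- the even cohomology is the direct sum of the `H^p(h, ⋀^q h)` with `p + q` even
    DirectSum.IsInternal (fun pq : {pq : ℕ × ℕ // Even (pq.1 + pq.2)} =>
      BigBracket.cohBidegree K h pq.1.1 pq.1.2) ∧
    Module.finrank K (BigBracket.EvenCohomology K h) = 18 ∧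
    Nonempty (BigBracket.EvenCohomology K h ≃ₗ⁅K⁆ GlSemidirect 3 K) ∧
    -- the Levi factors of `Der h` are copies of `sl(2)`, those of `H_E` are copies of `sl(3)`
    (∃ S : LieSubalgebra K (LieDerivation K h h), IsLeviFactor S) ∧
    (∀ S : LieSubalgebra K (LieDerivation K h h), IsLeviFactor S →
      Nonempty (S ≃ₗ⁅K⁆ LieAlgebra.SpecialLinear.sl (Fin 2) K)) ∧
    (∀ L : LieSubalgebra K (BigBracket.EvenCohomology K h), IsLeviFactor L →
      Nonempty (L ≃ₗ⁅K⁆ LieAlgebra.SpecialLinear.sl (Fin 3) K)) ∧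
    -- the canonical homomorphism `Der h → H^1(h, h) ⊆ H_E` embeds each Levi factor of `Der h`
    -- as a proper subalgebra of a Levi factor of `H_E`
    ∃ j : LieDerivation K h h →ₗ⁅K⁆ BigBracket.EvenCohomology K h,
      (∀ D : LieDerivation K h h, ∃ z : BigBracket.evenCocycles K h,
        z.val.val = -BigBracket.endCochain (D : h →ₗ[K] h) ∧ j D = BigBracket.cohClass z) ∧
      ∀ S : LieSubalgebra K (LieDerivation K h h), IsLeviFactor S →
        Set.InjOn j S ∧
          ∃ L : LieSubalgebra K (BigBracket.EvenCohomology K h), IsLeviFactor L ∧ S.map j < L := by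
  have := Heisenberg.finite_lieDerivation (K := K) (h := h)
  have := Heisenberg.finite_evenCohomology hx
  refine ⟨BigBracket.isInternal_cohBidegree hx, ?_, ⟨(BigBracket.cohEquiv hx).symm⟩,
    ⟨_, Heisenberg.isLeviFactor_derLevi hx⟩, ?_, ?_, Heisenberg.derClass hx,
    Heisenberg.derClass_spec hx, fun S hS => ⟨Heisenberg.derClass_injOn hx S hS, _,
      Heisenberg.isLeviFactor_cohLevi hx, Heisenberg.map_derClass_lt hx S⟩⟩
  · rw [← (BigBracket.cohEquiv hx).toLinearEquiv.finrank_eq, BigBracket.finrank_glSemidirect]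
  · exact LieAlgebra.leviFactor_equiv (Heisenberg.derSl₂ hx) (Heisenberg.derSl₂_surjective hx)
      (Heisenberg.isSolvable_ker_derSl₂ hx)
  · exact LieAlgebra.leviFactor_equiv (Heisenberg.cohSl₃ hx) (Heisenberg.cohSl₃_surjective hx)
      (Heisenberg.isSolvable_ker_cohSl₃ hx)
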